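/- Let $m=(m_0,m_1,\dots)$ be a bounded sequence of integers $m_k\ge 2$, let $G_m=\prod_{k\ge 0}\mathbb{Z}/m_k$ with the product probability measure $\mu$ of the uniform measures on the factors, and let $\digamma_n$ be the $\sigma$-algebra generated by the intervals $I_n(x)=\{y\in G_m: y_j=x_j \text{ for } j<n\}$, $x\in G_m$. Put $M_0=1$, $M_{k+1}=m_kM_k$, and write every $n\in\mathbb{N}$ uniquely as $n=\sum_j n_jM_j$ with $0\le n_j<m_j$. For $n\ge 1$ let $\langle n\rangle=\min\{j:n_j\ne 0\}$, $|n|=\max\{j:n_j\neq 0\}$ and $\rho(n)=|n|-\langle n\rangle$. Let $\psi_n(x)=\prod_{k}\exp(2\pi i\,n_kx_k/m_k)$ be the Vilenkin functions. For a (complex-valued) martingale $f=(f_n)_{n\in\mathbb{N}}$ with respect to $(\digamma_n)$ put $\widehat f(i)=\lim_{k\to\infty}\int_{G_m} f_k\overline{\psi_i}\,d\mu$, $S_nf=\sum_{k=0}^{n-1}\widehat f(k)\psi_k$, $f^*=\sup_n|f_n|$ and $\|f\|_{H_p}=\|f^*\|_p$, where $\|g\|_p=(\int_{G_m}|g|^p\,d\mu)^{1/p}$;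 $H_p$ is the space of all such martingales with $\|f\|_{H_p}<\infty$. Put $\|g\|_{L_{p,\infty}}=\sup_{\lambda>0}\lambda\,\mu(|g|>\lambda)^{1/p}$. (a) Let $0<p\le 1$ and let $(\alpha_k)_{k\in\mathbb{N}}$ be a sequence of positive integers with $\sup_k\rho(\alpha_k)<\infty$. Then the restricted maximal operator $f\mapsto\sup_{k}|S_{\alpha_k}f|$ is bounded from $H_p$ to $L_p$: there is a constant $C<\infty$ such that $\big\|\sup_k|S_{\alpha_k}f|\big\|_p\le C\,\|f\|_{H_p}$ for all $f\in H_p$. (b) Let $0<p<1$ and let $(\alpha_k)_{k\in\mathbb{N}}$ be a sequence of positive integers with $\sup_k\rho(\alpha_k)=\infty$. Then there is a martingale $f\in H_p$ such that $\sup_k\|S_{\alpha_k}f\|_{L_{p,\infty}}=\infty$. -/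

import Mathlib

open MeasureTheory ProbabilityTheory Filter
open scoped ENNReal NNReal

namespace Vilenkin

/-- The Vilenkin group `G_m`: the complete direct product of the groups `ℤ / m_k`. It carries the
product `σ`-algebra of the discrete `σ`-algebras. -/
abbrev Gm (m : ℕ → ℕ) : Type := ∀ k, ZMod (m k)

/-- The product of the measures `μ_k` with `μ_k {j} = 1 / m_k` on `ℤ / m_k`. -/
noncomputable def mu (m : ℕ → ℕ) : Measure (Gm m) :=
  Measure.infinitePi fun k => ((m k : ℝ≥0∞)⁻¹ • (Measure.count : Measure (ZMod (m k))))

/-- For `m_k ≥ 2` the factors are probability measures, so that the product measure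
is the genuine one. -/
theorem isProbabilityMeasure_factor {m : ℕ → ℕ} (hm : ∀ k, 2 ≤ m k) (k : ℕ) :
    IsProbabilityMeasure ((m k : ℝ≥0∞)⁻¹ • (Measure.count : Measure (ZMod (m k)))) := by
  have h := hm k
  have : NeZero (m k) := ⟨by omega⟩
  refine ⟨?_⟩
  have h0 : (m k : ℝ≥0∞) ≠ 0 := by
    have : m k ≠ 0 := by omega
    exact_mod_cast this
  rw [Measure.smul_apply, Measure.count_univ]
  simp only [ENat.card_eq_coe_fintype_card, ZMod.card, smul_eq_mul]
  exact ENNReal.inv_mul_cancel h0 (ENNReal.natCast_ne_top _)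

/-- The interval `I_n(x)`: all `y` whose first `n` coordinates agree with those of `x`. -/
def interval (m : ℕ → ℕ) (n : ℕ) (x : Gm m) : Set (Gm m) :=
  {y | ∀ j < n, y j = x j}

theorem measurableSet_interval (m : ℕ → ℕ) (n : ℕ) (x : Gm m) :
    MeasurableSet (interval m n x) := by
  have : interval m n x = ⋂ j ∈ Finset.range n, (fun y : Gm m => y j) ⁻¹' {x j} := by
    ext y
    simp [interval]
  rw [this]
  exact Finset.measurableSet_biInter _ fun j _ =>
    measurable_pi_apply j (measurableSet_singleton (x j))

theorem countable_range_interval (m : ℕ → ℕ) (n : ℕ) :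
    (Set.range (interval m n)).Countable := by
  have hsub : Set.range (interval m n) ⊆
      Set.range (fun t : (∀ j : Fin n, ZMod (m j)) =>
        {y : Gm m | ∀ j : Fin n, y j = t j}) := by
    rintro s ⟨x, rfl⟩
    refine ⟨fun j => x j, ?_⟩
    ext y
    exact ⟨fun h j hj => h ⟨j, hj⟩, fun h j => h j j.2⟩
  have : ∀ j, Countable (ZMod (m j)) := fun j => by
    rcases h : m j with _ | k
    · exact inferInstanceAs (Countable ℤ)
    · exact inferInstanceAs (Countable (Fin (k + 1)))
  exact (Set.countable_range _).mono hsub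

/-- The filtration `(F_n)`, where `F_n` is generated by the intervals `I_n(x)`. -/
def filtration (m : ℕ → ℕ) : Filtration ℕ (inferInstance : MeasurableSpace (Gm m)) where
  seq n := MeasurableSpace.generateFrom (Set.range (interval m n))
  mono' := by
    intro n n' hn
    refine MeasurableSpace.generateFrom_le ?_
    rintro s ⟨x, rfl⟩
    have : interval m n x = ⋃₀ (interval m n' '' interval m n x) := by
      ext y
      constructor
      · intro hy
        exact ⟨_, ⟨y, hy, rfl⟩, fun j _ => rfl⟩
      · rintro ⟨_, ⟨z, hz, rfl⟩, hy⟩ j hj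
        exact (hy j (lt_of_lt_of_le hj hn)).trans (hz j hj)
    rw [this]
    refine MeasurableSet.sUnion ((countable_range_interval m n').mono
      (Set.image_subset_range _ _)) ?_
    rintro _ ⟨z, _, rfl⟩
    exact MeasurableSpace.measurableSet_generateFrom ⟨z, rfl⟩
  le' n := by
    refine MeasurableSpace.generateFrom_le ?_
    rintro s ⟨x, rfl⟩
    exact measurableSet_interval m n x

/-- The generalized powers `M_0 = 1`, `M_{k+1} = m_k M_k`. -/
def bigM (m : ℕ → ℕ) : ℕ → ℕ
  | 0 => 1
  | k + 1 => m k * bigM m k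

/-- The digit `n_j` in the expansion `n = ∑ n_j M_j` with `0 ≤ n_j < m_j`. -/
def digit (m : ℕ → ℕ) (n j : ℕ) : ℕ := n / bigM m j % m j

/-- `⟨n⟩ = min {j : n_j ≠ 0}` (for `n ≠ 0`). -/
noncomputable def lowIndex (m : ℕ → ℕ) (n : ℕ) : ℕ := sInf {j | digit m n j ≠ 0}

/-- `|n| = max {j : n_j ≠ 0}` (for `n ≠ 0`). -/
noncomputable def highIndex (m : ℕ → ℕ) (n : ℕ) : ℕ := sSup {j | digit m n j ≠ 0}

/-- `ρ(n) = |n| - ⟨n⟩`. -/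
noncomputable def rho (m : ℕ → ℕ) (n : ℕ) : ℕ := highIndex m n - lowIndex m n

/-- The generalized Rademacher functions `r_k(x) = exp (2 π i x_k / m_k)`. -/
noncomputable def rademacher (m : ℕ → ℕ) (k : ℕ) (x : Gm m) : ℂ :=
  Complex.exp (2 * Real.pi * Complex.I * ((x k).val : ℂ) / (m k : ℂ))

/-- The Vilenkin functions `ψ_n = ∏_k r_k ^ n_k` (only finitely many factors differ from `1`). -/
noncomputable def psi (m : ℕ → ℕ) (n : ℕ) (x : Gm m) : ℂ :=
  ∏ᶠ k : ℕ, rademacher m k x ^ digit m n k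

/-- The Vilenkin-Fourier coefficients of a martingale, `lim_k ∫ f_k conj(ψ_i) dμ`. For a martingale
the integrals are constant for `M_k > i`, so the limit exists. -/
noncomputable def fourierCoeff (m : ℕ → ℕ) (f : ℕ → Gm m → ℂ) (i : ℕ) : ℂ :=
  limUnder atTop fun k : ℕ => ∫ x, f k x * (starRingEnd ℂ) (psi m i x) ∂(mu m)

/-- The partial sums `S_n f = ∑_{k < n} f̂(k) ψ_k`. -/
noncomputable def partialSum (m : ℕ → ℕ) (f : ℕ → Gm m → ℂ) (n : ℕ) (x : Gm m) : ℂ :=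
  ∑ k ∈ Finset.range n, fourierCoeff m f k * psi m k x

/-- The restricted maximal operator `sup_k |S_{α_k} f|`, with values in `[0, ∞]`. -/
noncomputable def restrictedMaximal (m α : ℕ → ℕ) (f : ℕ → Gm m → ℂ) (x : Gm m) : ℝ≥0∞ :=
  ⨆ k, ‖partialSum m f (α k) x‖ₑ

/-- The martingale maximal function `f^* = sup_n |f_n|`, with values in `[0, ∞]`. -/
noncomputable def maximalFunction (m : ℕ → ℕ) (f : ℕ → Gm m → ℂ) (x : Gm m) : ℝ≥0∞ :=
  ⨆ n, ‖f n x‖ₑ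

/-- The Hardy (quasi-)norm `‖f^*‖_p`. -/
noncomputable def hardyNorm (m : ℕ → ℕ) (p : ℝ) (f : ℕ → Gm m → ℂ) : ℝ≥0∞ :=
  eLpNorm (maximalFunction m f) (ENNReal.ofReal p) (mu m)

/-- Membership in the martingale Hardy space `H_p`. -/
def MemHardy (m : ℕ → ℕ) (p : ℝ) (f : ℕ → Gm m → ℂ) : Prop :=
  Martingale f (filtration m) (mu m) ∧ hardyNorm m p f < ⊤

/-- The weak (quasi-)norm `sup_{t > 0} t μ(|g| > t)^{1/p}` of `L_{p,∞}`. -/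
noncomputable def weakNorm (m : ℕ → ℕ) (p : ℝ) (g : Gm m → ℂ) : ℝ≥0∞ :=
  ⨆ (t : ℝ≥0) (_ : 0 < t),
    (t : ℝ≥0∞) * (mu m {x | (t : ℝ≥0∞) < ‖g x‖ₑ}) ^ (1 / p)

end Vilenkin

namespace Vilenkin

/-! Both parts rest on the Dirichlet kernel `D_a`. With `s = ⟨a⟩` and `N = |a|`, divisibility of `a`
by `M_s` confines `D_a` to `I_s(0)` (`dirichlet_eq_zero`), and `|D_a| ≤ a < M_{N+1}`.

(a) Convolving with `D_a` gives `|S_a f(x)| ≤ (M_{N+1}/M_s) sup_{I_s(x)} |f_{N+1}|`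
(`enorm_partialSum_le`), and bounded `ρ` bounds the ratio by `B^(R+1)`. The point where `|f_{N+1}|`
is large need not be `x`, but it lies in the same interval of level `s`. Enlarging sets of level
`s+R+1` to level `s` costs only a factor `B^(R+1)` in measure (`mu_exists_mem_interval_le`). Hence
the distribution function of the maximal operator is controlled by that of `f^*`, and the layer-cake
formula gives the norm bound. No atomic decomposition is needed.

(b) Take `f = ∑ c_i (D_{M_{i+1}} - D_{M_i})` with `c_i^p M_i^(p-1) = b_i` summable. Subadditivity of
`t ↦ t^p` puts `f` in `H_p`. For this `f`, `S_a f = f_N + c_N (D_a - D_{M_N})`. On the interval of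
level `s+1` where `x_j = 0` for `j < s` and `x_s = 1`, the kernel `D_{M_N}` vanishes if `s < N`,
while `|D_a| ≥ M_s` (`bigM_lowIndex_le_norm_dirichlet`). So either `S_a f` or `f^*` is of size `c_N
M_s` there. The `p`-th power of this size times the measure of the interval is at least a constant
times `b_N (M_N/M_s)^(1-p)`, which is unbounded along a choice of `a` with `ρ(a)` growing fast
relative to the decay of `b_N`. -/

instance neZero_of_fact {m : ℕ → ℕ} [hm : Fact (∀ k, 2 ≤ m k)] (k : ℕ) : NeZero (m k) :=
  ⟨by have := hm.out k; omega⟩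

/-! ### Mixed-radix digits and the lowest and highest nonzero digit -/

section Digits

variable {m : ℕ → ℕ} [hm : Fact (∀ k, 2 ≤ m k)]

omit hm in
theorem bigM_succ (k : ℕ) : bigM m (k + 1) = m k * bigM m k := rfl

theorem bigM_pos (k : ℕ) : 0 < bigM m k := by
  induction k with
  | zero => simp [bigM]
  | succ k ih => exact Nat.mul_pos (by have := hm.out k; omega) ih

theorem two_pow_mul_bigM_le (i j : ℕ) : 2 ^ j * bigM m i ≤ bigM m (i + j) := by
  induction j with
  | zero => simp
  | succ j ih =>
    rw [← add_assoc, bigM_succ, pow_succ, mul_comm (2 ^ j), mul_assoc]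
    exact Nat.mul_le_mul (hm.out _) ih

omit hm in
theorem bigM_add_le {B : ℕ} (hB : ∀ k, m k ≤ B) (i j : ℕ) :
    bigM m (i + j) ≤ B ^ j * bigM m i := by
  induction j with
  | zero => simp
  | succ j ih =>
    rw [← add_assoc, bigM_succ, pow_succ, mul_comm (B ^ j), mul_assoc]
    exact Nat.mul_le_mul (hB _) ih

omit hm in
theorem bigM_dvd_bigM {i j : ℕ} (h : i ≤ j) : bigM m i ∣ bigM m j := by
  induction j, h using Nat.le_induction with
  | base => exact dvd_rfl
  | succ j _ ih => exact ih.trans (Dvd.intro_left _ rfl)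

theorem bigM_mono : Monotone (bigM m) := fun _ _ h =>
  Nat.le_of_dvd (bigM_pos _) (bigM_dvd_bigM h)

theorem lt_bigM (n : ℕ) : n < bigM m n := by
  have := two_pow_mul_bigM_le (m := m) 0 n
  simp only [bigM, mul_one, zero_add] at this
  exact Nat.lt_two_pow_self.trans_le this

omit hm in
theorem digit_eq_zero_of_lt {n j : ℕ} (h : n < bigM m j) : digit m n j = 0 := by
  simp [digit, Nat.div_eq_of_lt h]

theorem digit_lt (n j : ℕ) : digit m n j < m j :=
  Nat.mod_lt _ (by have := hm.out j; omega)

theorem digit_mul_add_of_lt {s j : ℕ} (q r : ℕ) (hj : j < s) :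
    digit m (q * bigM m s + r) j = digit m r j := by
  obtain ⟨u, hu⟩ := bigM_dvd_bigM (m := m) (Nat.succ_le_of_lt hj)
  rw [bigM_succ] at hu
  have : q * bigM m s + r = r + bigM m j * (m j * (u * q)) := by rw [hu]; ring
  rw [digit, digit, this, Nat.add_mul_div_left _ _ (bigM_pos j), Nat.add_mul_mod_self_left]

theorem digit_mul_of_lt {s j : ℕ} (q : ℕ) (hj : j < s) : digit m (q * bigM m s) j = 0 := by
  simpa [digit] using digit_mul_add_of_lt (m := m) q 0 hj

theorem digit_mul_add_of_le {s j : ℕ} (q : ℕ) {r : ℕ} (hr : r < bigM m s) (hj : s ≤ j) :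
    digit m (q * bigM m s + r) j = digit m (q * bigM m s) j := by
  obtain ⟨u, hu⟩ := bigM_dvd_bigM (m := m) hj
  rw [digit, digit, hu, ← Nat.div_div_eq_div_mul, ← Nat.div_div_eq_div_mul,
    Nat.mul_div_cancel _ (bigM_pos s), mul_comm q, Nat.mul_add_div (bigM_pos s),
    Nat.div_eq_of_lt hr, add_zero]

omit hm in
theorem mod_bigM_congr {k l K : ℕ} (h : ∀ j < K, digit m k j = digit m l j) :
    k % bigM m K = l % bigM m K := by
  induction K with
  | zero => simp [bigM, Nat.mod_one]
  | succ K ih =>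
    have h1 := h K (Nat.lt_succ_self K)
    simp only [digit] at h1
    rw [bigM_succ, mul_comm, Nat.mod_mul, Nat.mod_mul,
      ih fun j hj => h j (hj.trans (Nat.lt_succ_self K)), h1]

theorem exists_digit_ne {k l : ℕ} (h : k ≠ l) : ∃ j, digit m k j ≠ digit m l j := by
  by_contra! H
  -- Both numbers are below `M_{k+l}`, so reduction modulo it changes neither.
  have := mod_bigM_congr (m := m) (K := k + l) fun j _ => H j
  rw [Nat.mod_eq_of_lt, Nat.mod_eq_of_lt] at this
  · exact h this
  · have := lt_bigM (m := m) (k + l); omega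
  · have := lt_bigM (m := m) (k + l); omega

theorem digit_lowIndex_ne_zero {n : ℕ} (hn : 0 < n) : digit m n (lowIndex m n) ≠ 0 := by
  have : {j | digit m n j ≠ 0}.Nonempty := by
    obtain ⟨j, hj⟩ := exists_digit_ne (m := m) hn.ne'
    exact ⟨j, by simpa [digit] using hj⟩
  exact Nat.sInf_mem this

omit hm in
theorem bigM_lowIndex_dvd (n : ℕ) : bigM m (lowIndex m n) ∣ n := by
  have : n % bigM m (lowIndex m n) = 0 % bigM m (lowIndex m n) := mod_bigM_congr fun j hj => by
    have := Nat.notMem_of_lt_sInf hj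
    simp only [Set.mem_ofPred_eq, not_not] at this
    rw [this]; simp [digit]
  exact Nat.dvd_of_mod_eq_zero (by simpa using this)

theorem exists_bigM_le_lt {n : ℕ} (hn : 0 < n) : ∃ N, bigM m N ≤ n ∧ n < bigM m (N + 1) := by
  classical
  have h : ∃ N, n < bigM m N := ⟨n, lt_bigM n⟩
  have h1 := Nat.find_spec h
  have h0 : Nat.find h ≠ 0 := by
    intro h0
    rw [h0] at h1
    simp [bigM] at h1
    omega
  obtain ⟨N, hN⟩ := Nat.exists_eq_succ_of_ne_zero h0
  refine ⟨N, ?_, by rw [hN] at h1; exact h1⟩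
  have := Nat.find_min h (m := N) (by omega)
  omega

theorem highIndex_eq {n N : ℕ} (h1 : bigM m N ≤ n) (h2 : n < bigM m (N + 1)) :
    highIndex m n = N := by
  refine IsGreatest.csSup_eq ⟨?_, fun j hj => ?_⟩
  · have h3 : n / bigM m N < m N := (Nat.div_lt_iff_lt_mul (bigM_pos N)).2 h2
    have h4 : 0 < n / bigM m N := Nat.div_pos h1 (bigM_pos N)
    simp only [Set.mem_ofPred_eq, digit, Nat.mod_eq_of_lt h3]
    omega
  · by_contra! H
    exact hj (digit_eq_zero_of_lt (h2.trans_le (bigM_mono (Nat.succ_le_of_lt H))))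

theorem bigM_highIndex_le {n : ℕ} (hn : 0 < n) : bigM m (highIndex m n) ≤ n := by
  obtain ⟨N, h1, h2⟩ := exists_bigM_le_lt (m := m) hn
  rwa [highIndex_eq h1 h2]

theorem lt_bigM_highIndex_succ {n : ℕ} (hn : 0 < n) : n < bigM m (highIndex m n + 1) := by
  obtain ⟨N, h1, h2⟩ := exists_bigM_le_lt (m := m) hn
  rwa [highIndex_eq h1 h2]

end Digits

/-! ### Intervals and measurability with respect to the filtration -/

section Intervals

variable {m : ℕ → ℕ}

theorem self_mem_interval (n : ℕ) (x : Gm m) : x ∈ interval m n x := fun _ _ => rfl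

theorem mem_interval_comm {n : ℕ} {x y : Gm m} : y ∈ interval m n x ↔ x ∈ interval m n y :=
  ⟨fun h j hj => (h j hj).symm, fun h j hj => (h j hj).symm⟩

theorem interval_trans {n : ℕ} {x y z : Gm m} (h : y ∈ interval m n x) (h' : z ∈ interval m n y) :
    z ∈ interval m n x := fun j hj => (h' j hj).trans (h j hj)

theorem interval_anti {n n' : ℕ} (h : n ≤ n') (x : Gm m) : interval m n' x ⊆ interval m n x :=
  fun _ hy j hj => hy j (hj.trans_le h)

/-- Such a set is a union of intervals of level `n`, and there are only countably many of these. -/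
theorem measurableSet_filtration_of_interval_subset {n : ℕ} {A : Set (Gm m)}
    (h : ∀ x ∈ A, interval m n x ⊆ A) : MeasurableSet[filtration m n] A := by
  have : A = ⋃₀ (interval m n '' A) := by
    ext y
    refine ⟨fun hy => ⟨_, ⟨y, hy, rfl⟩, self_mem_interval n y⟩, ?_⟩
    rintro ⟨_, ⟨z, hz, rfl⟩, hy⟩
    exact h z hz hy
  rw [this]
  refine MeasurableSet.sUnion ((countable_range_interval m n).mono
    (Set.image_subset_range _ _)) ?_
  rintro _ ⟨z, _, rfl⟩
  exact MeasurableSpace.measurableSet_generateFrom ⟨z, rfl⟩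

theorem measurableSet_of_interval_subset {n : ℕ} {A : Set (Gm m)}
    (h : ∀ x ∈ A, interval m n x ⊆ A) : MeasurableSet A :=
  (filtration m).le n _ (measurableSet_filtration_of_interval_subset h)

theorem mem_iff_of_measurableSet_filtration {n : ℕ} {A : Set (Gm m)}
    (hA : MeasurableSet[filtration m n] A) {x y : Gm m} (hy : y ∈ interval m n x) :
    x ∈ A ↔ y ∈ A := by
  have hA' : MeasurableSet[MeasurableSpace.generateFrom (Set.range (interval m n))] A := hA
  induction A, hA' using MeasurableSpace.generateFrom_induction with
  | hC t ht =>
    obtain ⟨z, rfl⟩ := ht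
    exact ⟨fun h => interval_trans h hy, fun h => interval_trans h (mem_interval_comm.1 hy)⟩
  | empty => simp
  | compl t ht ih => simpa using not_congr (ih ht)
  | iUnion s hs ih => simpa using exists_congr fun i => ih i (hs i)

theorem measurable_filtration_of_const {β : Type*} [MeasurableSpace β] {n : ℕ} {f : Gm m → β}
    (h : ∀ x, ∀ y ∈ interval m n x, f y = f x) : Measurable[filtration m n] f := fun s _ =>
  measurableSet_filtration_of_interval_subset fun x hx y hy => by
    simpa [Set.mem_preimage, h x y hy] using hx

theorem stronglyMeasurable_filtration_of_const {n : ℕ} {f : Gm m → ℂ}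
    (h : ∀ x, ∀ y ∈ interval m n x, f y = f x) : StronglyMeasurable[filtration m n] f :=
  (measurable_filtration_of_const h).stronglyMeasurable

theorem eq_of_stronglyMeasurable_filtration {n : ℕ} {f : Gm m → ℂ}
    (hf : StronglyMeasurable[filtration m n] f) {x y : Gm m} (hy : y ∈ interval m n x) :
    f y = f x :=
  (mem_iff_of_measurableSet_filtration (hf.measurable (measurableSet_singleton (f x))) hy).1 rfl

theorem measurableSet_mem_interval (n : ℕ) :
    MeasurableSet {p : Gm m × Gm m | p.2 ∈ interval m n p.1} := by
  have : {p : Gm m × Gm m | p.2 ∈ interval m n p.1} =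
      ⋂ j ∈ Finset.range n, {p : Gm m × Gm m | p.2 j = p.1 j} := by
    ext p
    simp [interval]
  rw [this]
  refine Finset.measurableSet_biInter _ fun j _ => ?_
  have : Countable (ZMod (m j)) := by
    rcases h : m j with _ | k
    · exact inferInstanceAs (Countable ℤ)
    · exact inferInstanceAs (Countable (Fin (k + 1)))
  exact measurableSet_eq_fun ((measurable_pi_apply j).comp measurable_snd)
    ((measurable_pi_apply j).comp measurable_fst)

end Intervals

/-! ### The product measure, translations and the covering estimate -/

section Measure

variable {m : ℕ → ℕ} [hm : Fact (∀ k, 2 ≤ m k)]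

instance isProbabilityMeasure_factor' (k : ℕ) :
    IsProbabilityMeasure ((m k : ℝ≥0∞)⁻¹ • (Measure.count : Measure (ZMod (m k)))) :=
  isProbabilityMeasure_factor hm.out k

instance isProbabilityMeasure_mu : IsProbabilityMeasure (mu m) := by
  unfold mu
  infer_instance

theorem mu_interval (n : ℕ) (x : Gm m) : mu m (interval m n x) = (bigM m n : ℝ≥0∞)⁻¹ := by
  have : interval m n x = Set.pi (Finset.range n) fun j => {x j} := by
    ext y
    simp [interval, Set.pi]
  rw [this, mu, Measure.infinitePi_pi _ fun j _ => measurableSet_singleton _]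
  simp only [Measure.smul_apply, Measure.count_singleton, smul_eq_mul, mul_one]
  induction n with
  | zero => simp [bigM]
  | succ n ih =>
    rw [Finset.prod_range_succ, ih (by ext y; simp [interval, Set.pi]), bigM_succ, Nat.cast_mul,
      ENNReal.mul_inv (Or.inr (ENNReal.natCast_ne_top _)) (Or.inl (ENNReal.natCast_ne_top _)),
      mul_comm]

theorem measurePreserving_add (e : Gm m) : MeasurePreserving (fun x => x + e) (mu m) (mu m) := by
  refine ⟨measurable_pi_lambda _ fun i =>
    (measurable_of_countable (fun t : ZMod (m i) => t + e i)).comp (measurable_pi_apply i), ?_⟩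
  have h := Measure.infinitePi_map_pi
    (fun k => ((m k : ℝ≥0∞)⁻¹ • (Measure.count : Measure (ZMod (m k)))))
    (f := fun i (t : ZMod (m i)) => t + e i) fun i => measurable_of_countable _
  unfold mu
  refine h.trans ?_
  congr 1
  ext1 i
  rw [Measure.map_smul]
  congr 1
  ext s hs
  rw [Measure.map_apply (measurable_of_countable _) hs]
  rw [Measure.count_apply (measurable_of_countable _ hs), Measure.count_apply hs,
    Set.encard_preimage_of_bijective (f := fun t : ZMod (m i) => t + e i)
      (Equiv.addRight (e i)).bijective]

/-- If every point of a set `T` of level `s` has in its interval of level `s` a point of a set `Q`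
of level `n`, then `μ T ≤ (M_n / M_s) μ (T ∩ Q)`. -/
theorem mu_le_mul_mu_inter {s n : ℕ} (hsn : s ≤ n) {T Q : Set (Gm m)}
    (hT : ∀ x ∈ T, interval m s x ⊆ T) (hQ : ∀ x ∈ Q, interval m n x ⊆ Q)
    (h : ∀ x ∈ T, ∃ y ∈ interval m s x, y ∈ Q) :
    mu m T ≤ (bigM m n * (bigM m s : ℝ≥0∞)⁻¹) * mu m (T ∩ Q) := by
  have hTm := measurableSet_of_interval_subset hT
  have hQm := measurableSet_of_interval_subset hQ
  have hM : (bigM m n : ℝ≥0∞) ≠ 0 := by exact_mod_cast (bigM_pos n).ne'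
  -- `I_s(x)` contains the whole interval `I_n(y)`, which lies in `T ∩ Q` and has measure `1/M_n`.
  have h1 : ∀ x ∈ T, 1 ≤ bigM m n * mu m (interval m s x ∩ (T ∩ Q)) := by
    intro x hx
    obtain ⟨y, hy, hyQ⟩ := h x hx
    calc (1 : ℝ≥0∞) = bigM m n * mu m (interval m n y) := by
          rw [mu_interval, ENNReal.mul_inv_cancel hM (ENNReal.natCast_ne_top _)]
      _ ≤ _ := by
          gcongr
          intro z hz
          have : z ∈ interval m s x := interval_trans hy (interval_anti hsn y hz)
          exact ⟨this, hT x hx this, hQ y hyQ hz⟩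
  have hm2 : Measurable (Function.uncurry fun x y : Gm m =>
      (interval m s x ∩ (T ∩ Q)).indicator (fun _ => (1 : ℝ≥0∞)) y) := by
    have : (Function.uncurry fun x y : Gm m =>
      (interval m s x ∩ (T ∩ Q)).indicator (fun _ => (1 : ℝ≥0∞)) y) =
      ({p : Gm m × Gm m | p.2 ∈ interval m s p.1} ∩ Prod.snd ⁻¹' (T ∩ Q)).indicator
        fun _ => 1 := by
      ext ⟨x, y⟩
      simp only [Function.uncurry, Set.indicator]
      rfl
    rw [this]
    exact measurable_const.indicator ((measurableSet_mem_interval s).inter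
      (measurable_snd (hTm.inter hQm)))
  calc mu m T = ∫⁻ x in T, 1 ∂mu m := by simp
    _ ≤ ∫⁻ x in T, bigM m n * mu m (interval m s x ∩ (T ∩ Q)) ∂mu m :=
        setLIntegral_mono' hTm h1
    _ ≤ ∫⁻ x, bigM m n * mu m (interval m s x ∩ (T ∩ Q)) ∂mu m := setLIntegral_le_lintegral _ _
    _ = bigM m n * ∫⁻ x, mu m (interval m s x ∩ (T ∩ Q)) ∂mu m :=
        lintegral_const_mul' _ _ (ENNReal.natCast_ne_top _)
    _ = bigM m n * ∫⁻ x, ∫⁻ y, (interval m s x ∩ (T ∩ Q)).indicator (fun _ => 1) y ∂mu m ∂mu m := by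
        congr 1
        refine lintegral_congr fun x => ?_
        rw [lintegral_indicator ((measurableSet_interval m s x).inter (hTm.inter hQm))]
        simp
    -- After the swap, the symmetry `y ∈ I_s(x) ↔ x ∈ I_s(y)` counts each `y ∈ T ∩ Q` with weight
    -- `μ(I_s(y)) = 1/M_s`.
    _ = bigM m n * ∫⁻ y, ∫⁻ x, (interval m s x ∩ (T ∩ Q)).indicator (fun _ => 1) y ∂mu m ∂mu m := by
        rw [lintegral_lintegral_swap hm2.aemeasurable]
    _ = bigM m n * ∫⁻ y, (T ∩ Q).indicator (fun _ => (bigM m s : ℝ≥0∞)⁻¹) y ∂mu m := by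
        congr 1
        refine lintegral_congr fun y => ?_
        by_cases hy : y ∈ T ∩ Q
        · rw [Set.indicator_of_mem hy, ← mu_interval s y,
            ← lintegral_indicator_one (measurableSet_interval m s y)]
          refine lintegral_congr fun x => ?_
          by_cases hx : x ∈ interval m s y
          · rw [Set.indicator_of_mem hx, Set.indicator_of_mem (s := interval m s x ∩ (T ∩ Q))
              ⟨mem_interval_comm.1 hx, hy⟩]
            rfl
          · rw [Set.indicator_of_notMem hx,
              Set.indicator_of_notMem fun h => hx (mem_interval_comm.1 h.1)]
        · rw [Set.indicator_of_notMem hy]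
          have : ∀ x, y ∉ interval m s x ∩ (T ∩ Q) := fun x h => hy h.2
          simp [Set.indicator_of_notMem (this _)]
    _ = _ := by
        rw [lintegral_indicator (hTm.inter hQm)]
        simp [mul_assoc]

/-- The covering estimate: enlarging sets `Q s` of level `s + j` to sets of level `s` increases the
measure of their union at most by the factor `B ^ j`. -/
theorem mu_exists_mem_interval_le {B : ℕ} (hB : ∀ k, m k ≤ B) (j : ℕ) (Q : ℕ → Set (Gm m))
    (hQ : ∀ s, ∀ x ∈ Q s, interval m (s + j) x ⊆ Q s) :
    mu m {x | ∃ s, ∃ y ∈ interval m s x, y ∈ Q s} ≤ (B : ℝ≥0∞) ^ j * mu m (⋃ s, Q s) := by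
  set P : ℕ → Set (Gm m) := fun s => {x | ∃ y ∈ interval m s x, y ∈ Q s} with hP
  have hPinv : ∀ s, ∀ x ∈ P s, interval m s x ⊆ P s := by
    rintro s x ⟨y, hy, hyQ⟩ z hz
    exact ⟨y, interval_trans (mem_interval_comm.1 hz) hy, hyQ⟩
  -- Disjointification removes only the `P i` with `i < s`, which are unions of coarser intervals,
  -- so level `s` is preserved.
  have hinv : ∀ s, ∀ x ∈ disjointed P s, interval m s x ⊆ disjointed P s := by
    intro s x hx z hz
    rw [disjointed_eq_inter_compl] at hx ⊢
    refine ⟨hPinv s x hx.1 hz, ?_⟩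
    have := hx.2
    simp only [Set.mem_iInter, Set.mem_compl_iff] at this ⊢
    intro i hi hzi
    exact this i hi (hPinv i z hzi (interval_anti hi.le z (mem_interval_comm.1 hz)))
  have hQm : MeasurableSet (⋃ s, Q s) :=
    MeasurableSet.iUnion fun s => measurableSet_of_interval_subset (hQ s)
  have hle : ∀ s, mu m (disjointed P s) ≤
      (B : ℝ≥0∞) ^ j * mu m (disjointed P s ∩ ⋃ s, Q s) := by
    intro s
    refine (mu_le_mul_mu_inter (Nat.le_add_right s j) (hinv s) (hQ s)
      fun x hx => disjointed_subset P s hx).trans ?_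
    gcongr
    · have hM : (bigM m s : ℝ≥0∞) ≠ 0 := by exact_mod_cast (bigM_pos s).ne'
      rw [← div_eq_mul_inv]
      refine ENNReal.div_le_of_le_mul ?_
      exact_mod_cast bigM_add_le hB s j
    · exact Set.subset_iUnion Q s
  have hset : {x | ∃ s, ∃ y ∈ interval m s x, y ∈ Q s} = ⋃ s, disjointed P s := by
    rw [iUnion_disjointed]
    ext x
    simp [hP]
  have hdm : ∀ s, MeasurableSet (disjointed P s) := fun s =>
    measurableSet_of_interval_subset (hinv s)
  rw [hset, measure_iUnion (disjoint_disjointed P) hdm]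
  calc ∑' s, mu m (disjointed P s) ≤ ∑' s, (B : ℝ≥0∞) ^ j * mu m (disjointed P s ∩ ⋃ s, Q s) :=
        ENNReal.tsum_le_tsum hle
    _ = (B : ℝ≥0∞) ^ j * ∑' s, mu m (disjointed P s ∩ ⋃ s, Q s) := ENNReal.tsum_mul_left
    _ = (B : ℝ≥0∞) ^ j * mu m (⋃ s, (disjointed P s ∩ ⋃ s, Q s)) := by
        rw [measure_iUnion _ fun s => (hdm s).inter hQm]
        intro s t hst
        exact (disjoint_disjointed P hst).mono Set.inter_subset_left Set.inter_subset_left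
    _ ≤ _ := by
        gcongr _ * mu m ?_
        exact Set.iUnion_subset fun s => Set.inter_subset_right

end Measure

/-! ### The layer-cake comparison -/

section LayerCake

/-- A comparison of distribution functions gives a comparison of integrals. -/
theorem lintegral_le_mul_of_meas_lt_le {Ω : Type*} [MeasurableSpace Ω] {μ : Measure Ω}
    [SFinite μ] {u v : Ω → ℝ≥0∞} (hu : Measurable u) (hv : Measurable v) {C : ℝ≥0∞} (hC : C ≠ ⊤)
    (h : ∀ t : ℝ≥0, 0 < t → μ {x | t < u x} ≤ C * μ {x | t < v x}) :
    ∫⁻ x, u x ∂μ ≤ C * ∫⁻ x, v x ∂μ := by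
  have key : ∀ w : Ω → ℝ≥0∞, Measurable w →
      ∫⁻ x, w x ∂μ = ∫⁻ t in Set.Ioi (0 : ℝ), μ {x | ENNReal.ofReal t < w x} := by
    intro w hw
    have h1 : ∀ a : ℝ≥0∞, volume {t : ℝ | t ∈ Set.Ioi 0 ∧ ENNReal.ofReal t < a} = a := by
      intro a
      induction a using ENNReal.recTopCoe with
      | top =>
        have : {t : ℝ | t ∈ Set.Ioi 0 ∧ ENNReal.ofReal t < ⊤} = Set.Ioi 0 := by
          ext t; simp
        rw [this, Real.volume_Ioi]
      | coe a =>
        have : {t : ℝ | t ∈ Set.Ioi 0 ∧ ENNReal.ofReal t < a} = Set.Ioo 0 (a : ℝ) := by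
          ext t
          simp only [Set.mem_Ioi, Set.mem_Ioo, Set.mem_ofPred_eq]
          refine and_congr_right fun ht => ?_
          rw [← ENNReal.ofReal_coe_nnreal, ENNReal.ofReal_lt_ofReal_iff_of_nonneg ht.le]
        rw [this, Real.volume_Ioo]
        simp
    have hms : MeasurableSet {p : Ω × ℝ | ENNReal.ofReal p.2 < w p.1} :=
      measurableSet_lt (ENNReal.measurable_ofReal.comp measurable_snd) (hw.comp measurable_fst)
    have hm2 : Measurable (Function.uncurry fun (x : Ω) (t : ℝ) =>
        {p : Ω × ℝ | ENNReal.ofReal p.2 < w p.1}.indicator (fun _ => (1 : ℝ≥0∞)) (x, t)) :=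
      measurable_const.indicator hms
    calc ∫⁻ x, w x ∂μ = ∫⁻ x, ∫⁻ t in Set.Ioi (0 : ℝ),
          {p : Ω × ℝ | ENNReal.ofReal p.2 < w p.1}.indicator (fun _ => (1 : ℝ≥0∞)) (x, t) ∂volume ∂μ := by
          refine lintegral_congr fun x => ?_
          have hmx : MeasurableSet {t : ℝ | ENNReal.ofReal t < w x} :=
            measurableSet_lt ENNReal.measurable_ofReal measurable_const
          have : ∀ t, {p : Ω × ℝ | ENNReal.ofReal p.2 < w p.1}.indicator
              (fun _ => (1 : ℝ≥0∞)) (x, t) =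
              {t : ℝ | ENNReal.ofReal t < w x}.indicator 1 t := fun t => by
            simp [Set.indicator]
          simp_rw [this]
          rw [lintegral_indicator_one hmx, Measure.restrict_apply hmx]
          conv_lhs => rw [← h1 (w x)]
          congr 1
          ext t
          simp [and_comm]
      _ = ∫⁻ t in Set.Ioi (0 : ℝ), ∫⁻ x,
          {p : Ω × ℝ | ENNReal.ofReal p.2 < w p.1}.indicator (fun _ => (1 : ℝ≥0∞)) (x, t) ∂μ ∂volume :=
          lintegral_lintegral_swap hm2.aemeasurable
      _ = _ := by
          refine lintegral_congr fun t => ?_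
          rw [← lintegral_indicator_one (measurableSet_lt measurable_const hw)]
          rfl
  rw [key u hu, key v hv, ← lintegral_const_mul' _ _ hC]
  refine setLIntegral_mono' measurableSet_Ioi fun t ht => ?_
  exact h t.toNNReal (by simpa using ht)

end LayerCake

/-! ### Vilenkin functions as characters, and Dirichlet kernels -/

section Characters

variable {m : ℕ → ℕ} [hm : Fact (∀ k, 2 ≤ m k)]

theorem rademacher_eq_stdAddChar (k : ℕ) (x : Gm m) :
    rademacher m k x = ZMod.stdAddChar (x k) := by
  have : (((x k).val : ℤ) : ZMod (m k)) = x k := by simp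
  rw [rademacher, ← this, ZMod.stdAddChar_coe]
  simp

theorem rademacher_add (k : ℕ) (x y : Gm m) :
    rademacher m k (x + y) = rademacher m k x * rademacher m k y := by
  simp only [rademacher_eq_stdAddChar, Pi.add_apply, AddChar.map_add_eq_mul]

theorem norm_rademacher (k : ℕ) (x : Gm m) : ‖rademacher m k x‖ = 1 := by
  rw [rademacher_eq_stdAddChar, ZMod.stdAddChar_apply, Circle.norm_coe]

theorem rademacher_eq_one_iff {k : ℕ} {x : Gm m} : rademacher m k x = 1 ↔ x k = 0 := by
  rw [rademacher_eq_stdAddChar, ← AddChar.map_zero_eq_one (ZMod.stdAddChar (N := m k)),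
    ZMod.injective_stdAddChar.eq_iff]

theorem rademacher_pow_self (k : ℕ) (x : Gm m) : rademacher m k x ^ m k = 1 := by
  rw [rademacher_eq_stdAddChar, ← AddChar.map_nsmul_eq_pow]
  simp

theorem psi_eq_prod {n K : ℕ} (h : n < bigM m K) (x : Gm m) :
    psi m n x = ∏ k ∈ Finset.range K, rademacher m k x ^ digit m n k := by
  refine finprod_eq_prod_of_mulSupport_subset _ fun k hk => ?_
  by_contra H
  refine hk ?_
  simp only [Finset.coe_range, Set.mem_Iio, not_lt] at H
  simp [digit_eq_zero_of_lt (h.trans_le (bigM_mono H))]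

theorem psi_add (n : ℕ) (x y : Gm m) : psi m n (x + y) = psi m n x * psi m n y := by
  simp only [psi_eq_prod (lt_bigM n), rademacher_add, mul_pow, Finset.prod_mul_distrib]

theorem norm_psi (n : ℕ) (x : Gm m) : ‖psi m n x‖ = 1 := by
  simp [psi_eq_prod (lt_bigM n), norm_rademacher]

omit hm in
theorem psi_zero_left (x : Gm m) : psi m 0 x = 1 := by
  simp [psi, digit]

theorem psi_zero_right (n : ℕ) : psi m n (0 : Gm m) = 1 := by
  rw [psi_eq_prod (lt_bigM n)]
  exact Finset.prod_eq_one fun k _ => by rw [rademacher_eq_one_iff.2 rfl, one_pow]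

theorem conj_psi (n : ℕ) (x : Gm m) : (starRingEnd ℂ) (psi m n x) = psi m n (-x) := by
  have h1 : psi m n x * psi m n (-x) = 1 := by rw [← psi_add, add_neg_cancel, psi_zero_right]
  have h0 : psi m n x ≠ 0 := left_ne_zero_of_mul_eq_one h1
  have h2 : psi m n x * (starRingEnd ℂ) (psi m n x) = 1 := by
    rw [Complex.mul_conj, Complex.normSq_eq_norm_sq, norm_psi]; simp
  exact mul_left_cancel₀ h0 (h2.trans h1.symm)

theorem psi_eq_of_mem_interval {n K : ℕ} (h : n < bigM m K) {x y : Gm m}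
    (hy : y ∈ interval m K x) : psi m n y = psi m n x := by
  rw [psi_eq_prod h, psi_eq_prod h]
  refine Finset.prod_congr rfl fun k hk => ?_
  rw [rademacher_eq_stdAddChar, rademacher_eq_stdAddChar, hy k (Finset.mem_range.1 hk)]

theorem stronglyMeasurable_psi_filtration {n K : ℕ} (h : n < bigM m K) :
    StronglyMeasurable[filtration m K] (psi m n) :=
  stronglyMeasurable_filtration_of_const fun _ _ hy => psi_eq_of_mem_interval h hy

theorem stronglyMeasurable_psi (n : ℕ) : StronglyMeasurable (psi m n) :=
  (stronglyMeasurable_psi_filtration (lt_bigM n)).mono ((filtration m).le n)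

theorem psi_mul_add {s : ℕ} (q : ℕ) {r : ℕ} (hr : r < bigM m s) (x : Gm m) :
    psi m (q * bigM m s + r) x = psi m (q * bigM m s) x * psi m r x := by
  set K := q * bigM m s + r with hK
  have hKlt := lt_bigM (m := m) K
  rw [psi_eq_prod hKlt, psi_eq_prod (show q * bigM m s < bigM m K by omega),
    psi_eq_prod (show r < bigM m K by omega), ← Finset.prod_mul_distrib]
  refine Finset.prod_congr rfl fun j _ => ?_
  rw [← pow_add]
  congr 1
  rcases lt_or_ge j s with hj | hj
  · rw [hK, digit_mul_add_of_lt q r hj, digit_mul_of_lt q hj, zero_add]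
  · rw [hK, digit_mul_add_of_le q hr hj, digit_eq_zero_of_lt (hr.trans_le (bigM_mono hj)),
      add_zero]

theorem psi_mul_bigM {s t : ℕ} (ht : t < m s) (x : Gm m) :
    psi m (t * bigM m s) x = rademacher m s x ^ t := by
  have hlt : t * bigM m s < bigM m (s + 1) := by
    rw [bigM_succ]; exact Nat.mul_lt_mul_of_pos_right ht (bigM_pos s)
  rw [psi_eq_prod hlt, Finset.prod_range_succ, Finset.prod_eq_one, one_mul]
  · congr 1
    rw [digit, Nat.mul_div_cancel _ (bigM_pos s), Nat.mod_eq_of_lt ht]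
  · intro j hj
    rw [digit_mul_of_lt t (Finset.mem_range.1 hj), pow_zero]

theorem psi_single (n j : ℕ) :
    psi m n (Pi.single j 1) = ZMod.stdAddChar ((digit m n j : ℕ) : ZMod (m j)) := by
  have hlt : n < bigM m (n + j + 1) := (lt_bigM n).trans_le (bigM_mono (by omega))
  rw [psi_eq_prod hlt, Finset.prod_eq_single j]
  · rw [rademacher_eq_stdAddChar, Pi.single_eq_same, ← AddChar.map_nsmul_eq_pow]
    simp
  · intro k _ hk
    rw [rademacher_eq_one_iff.2 (Pi.single_eq_of_ne hk _), one_pow]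
  · intro h
    exact absurd (Finset.mem_range.2 (by omega)) h

theorem psi_single_ne {k l j : ℕ} (h : digit m k j ≠ digit m l j) :
    psi m k (Pi.single j 1) ≠ psi m l (Pi.single j 1) := by
  rw [psi_single, psi_single, ZMod.injective_stdAddChar.ne_iff]
  intro H
  rw [ZMod.natCast_eq_natCast_iff', Nat.mod_eq_of_lt (digit_lt k j),
    Nat.mod_eq_of_lt (digit_lt l j)] at H
  exact h H

/-- A set integral vanishes if a translation preserves the set and multiplies the integrand by
a constant different from `1`. -/
theorem setIntegral_eq_zero_of_translate {F : Gm m → ℂ} (hF : StronglyMeasurable F)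
    {A : Set (Gm m)} (hA : MeasurableSet A) {e : Gm m} {ω : ℂ} (hω : ω ≠ 1)
    (hAe : ∀ x, x + e ∈ A ↔ x ∈ A) (hFe : ∀ x, F (x + e) = ω * F x) :
    ∫ x in A, F x ∂mu m = 0 := by
  have hmp := measurePreserving_add e
  have h1 : ∫ x, A.indicator F x ∂mu m = ω * ∫ x, A.indicator F x ∂mu m := by
    conv_lhs => rw [← hmp.map_eq]
    rw [integral_map hmp.measurable.aemeasurable (hF.indicator hA).aestronglyMeasurable,
      ← integral_const_mul]
    refine integral_congr_ae (ae_of_all _ fun x => ?_)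
    by_cases hx : x ∈ A
    · simp [hx, (hAe x).2 hx, hFe]
    · simp [hx, mt (hAe x).1 hx]
  rw [integral_indicator hA] at h1
  have h2 : (ω - 1) * ∫ x in A, F x ∂mu m = 0 := by rw [sub_mul, one_mul, ← h1, sub_self]
  exact (mul_eq_zero.1 h2).resolve_left (sub_ne_zero.2 hω)

/-- If `k ≠ l`, some digit `j` differs, and translation by the unit vector in coordinate `j`
multiplies the integrand by a root of unity other than `1`. -/
theorem integral_psi_mul_conj_psi (k l : ℕ) :
    ∫ x, psi m k x * (starRingEnd ℂ) (psi m l x) ∂mu m = if k = l then 1 else 0 := by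
  split_ifs with h
  · subst h
    have : ∀ x : Gm m, psi m k x * (starRingEnd ℂ) (psi m k x) = 1 := fun x => by
      rw [Complex.mul_conj, Complex.normSq_eq_norm_sq, norm_psi]; simp
    simp [this]
  · obtain ⟨j, hj⟩ := exists_digit_ne (m := m) h
    rw [← setIntegral_univ]
    have hne := psi_single_ne hj
    refine setIntegral_eq_zero_of_translate (e := Pi.single j 1)
      (ω := psi m k (Pi.single j 1) * (starRingEnd ℂ) (psi m l (Pi.single j 1)))
      ((stronglyMeasurable_psi k).mul
        (Complex.continuous_conj.comp_stronglyMeasurable (stronglyMeasurable_psi l)))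
      MeasurableSet.univ ?_ (by simp) fun x => ?_
    · intro H
      apply hne
      have h2 : psi m l (Pi.single j 1) * (starRingEnd ℂ) (psi m l (Pi.single j 1)) = 1 := by
        rw [Complex.mul_conj, Complex.normSq_eq_norm_sq, norm_psi]; simp
      exact mul_right_cancel₀ (right_ne_zero_of_mul_eq_one h2) (H.trans h2.symm)
    · change psi m k (x + _) * (starRingEnd ℂ) (psi m l (x + _)) =
        _ * (psi m k x * (starRingEnd ℂ) (psi m l x))
      rw [psi_add, psi_add, map_mul]; ring

/-- `k` has a nonzero digit at some `j ≥ n`. Translation in coordinate `j` preserves sets of level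
`n` but multiplies `ψ_k` by a constant different from `1`. -/
theorem setIntegral_psi_eq_zero {n k : ℕ} (hk : bigM m n ≤ k) {A : Set (Gm m)}
    (hA : MeasurableSet[filtration m n] A) : ∫ x in A, psi m k x ∂mu m = 0 := by
  have hk0 : 0 < k := (bigM_pos n).trans_le hk
  obtain ⟨j, hj⟩ : ∃ j, n ≤ j ∧ digit m k j ≠ 0 := by
    by_contra! H
    have h1 : digit m k (highIndex m k) = k / bigM m (highIndex m k) := by
      refine Nat.mod_eq_of_lt ((Nat.div_lt_iff_lt_mul (bigM_pos _)).2 ?_)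
      exact lt_bigM_highIndex_succ hk0
    have h2 := Nat.div_pos (bigM_highIndex_le (m := m) hk0) (bigM_pos _)
    have h3 : n ≤ highIndex m k := by
      by_contra! h
      have := (lt_bigM_highIndex_succ (m := m) hk0).trans_le (bigM_mono (Nat.succ_le_of_lt h))
      omega
    have := H _ h3
    omega
  refine setIntegral_eq_zero_of_translate (e := Pi.single j 1) (ω := psi m k (Pi.single j 1))
    (stronglyMeasurable_psi k) ((filtration m).le n _ hA) ?_ (fun x => ?_) fun x => ?_
  · rw [← psi_zero_left (m := m) (Pi.single j 1)]
    refine psi_single_ne ?_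
    simpa [digit] using hj.2
  · refine (mem_iff_of_measurableSet_filtration hA fun i hi => ?_).symm
    have : i ≠ j := by omega
    simp [Pi.single_eq_of_ne this]
  · rw [psi_add, mul_comm]

/-- The Dirichlet kernels `D_n = ∑_{k < n} ψ_k`. -/
noncomputable def dirichlet (m : ℕ → ℕ) (n : ℕ) (x : Gm m) : ℂ :=
  ∑ k ∈ Finset.range n, psi m k x

/-- The indices beyond `a M_s` split into `b` blocks of length `M_s`; on each, `ψ_{qM_s+r} =
ψ_{qM_s} ψ_r` factors out a copy of `D_{M_s}`. -/
theorem dirichlet_add_mul {a b s : ℕ} (x : Gm m) :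
    dirichlet m ((a + b) * bigM m s) x = dirichlet m (a * bigM m s) x +
      (∑ q ∈ Finset.range b, psi m ((a + q) * bigM m s) x) * dirichlet m (bigM m s) x := by
  induction b with
  | zero => simp
  | succ b ih =>
    rw [← add_assoc, add_mul _ 1, one_mul, dirichlet, Finset.sum_range_add, Finset.sum_range_succ,
      add_mul (∑ _ ∈ _, _), ← add_assoc, ← ih, dirichlet, dirichlet, Finset.mul_sum]
    congr 1
    exact Finset.sum_congr rfl fun r hr => psi_mul_add _ (Finset.mem_range.1 hr) x

theorem dirichlet_mul (a s : ℕ) (x : Gm m) :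
    dirichlet m (a * bigM m s) x =
      (∑ q ∈ Finset.range a, psi m (q * bigM m s) x) * dirichlet m (bigM m s) x := by
  simpa [dirichlet] using dirichlet_add_mul (a := 0) (b := a) (s := s) x

open scoped Classical in
theorem dirichlet_bigM (s : ℕ) (x : Gm m) :
    dirichlet m (bigM m s) x = if x ∈ interval m s 0 then (bigM m s : ℂ) else 0 := by
  induction s with
  | zero =>
    have : x ∈ interval m 0 0 := fun j hj => absurd hj (Nat.not_lt_zero j)
    simp [this, bigM, dirichlet, psi_zero_left]
  | succ s ih =>
    have hiff : x ∈ interval m (s + 1) 0 ↔ x ∈ interval m s 0 ∧ x s = 0 := by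
      simp only [interval, Set.mem_ofPred_eq]
      exact Nat.forall_lt_succ_right
    rw [if_congr hiff rfl rfl, bigM_succ, dirichlet_mul, ih,
      Finset.sum_congr rfl fun t ht => psi_mul_bigM (Finset.mem_range.1 ht) x]
    by_cases hx : x s = 0
    · rw [rademacher_eq_one_iff.2 hx]
      by_cases hs : x ∈ interval m s 0 <;> simp [hx, hs]
    -- The sum runs over all powers of a nontrivial `m_s`-th root of unity, hence vanishes.
    · have h1 : rademacher m s x ≠ 1 := mt rademacher_eq_one_iff.1 hx
      rw [geom_sum_eq h1, rademacher_pow_self]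
      simp [hx]

theorem dirichlet_eq_zero {s n : ℕ} (h : bigM m s ∣ n) {x : Gm m} (hx : x ∉ interval m s 0) :
    dirichlet m n x = 0 := by
  classical
  obtain ⟨a, rfl⟩ := h
  rw [mul_comm, dirichlet_mul, dirichlet_bigM, if_neg hx, mul_zero]

theorem norm_dirichlet_le (n : ℕ) (x : Gm m) : ‖dirichlet m n x‖ ≤ n := by
  refine (norm_sum_le _ _).trans ?_
  simp [norm_psi]

theorem stronglyMeasurable_dirichlet (n : ℕ) : StronglyMeasurable (dirichlet m n) :=
  Finset.stronglyMeasurable_fun_sum _ fun k _ => stronglyMeasurable_psi k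

end Characters

/-! ### Fourier coefficients and partial sums of martingales -/

section Martingales

variable {m : ℕ → ℕ} [hm : Fact (∀ k, 2 ≤ m k)] {f : ℕ → Gm m → ℂ}

theorem _root_.MeasureTheory.Integrable.mul_conj_psi {g : Gm m → ℂ} (hg : Integrable g (mu m))
    (i : ℕ) : Integrable (fun x => g x * (starRingEnd ℂ) (psi m i x)) (mu m) := by
  refine hg.mul_bdd (c := 1)
    (Complex.continuous_conj.comp_stronglyMeasurable (stronglyMeasurable_psi i)).aestronglyMeasurable
    (ae_of_all _ fun x => ?_)
  simp [norm_psi]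

/-- For `i < M_n` the function `ψ_i` is measurable at level `n`, so it comes out of the conditional
expectation and the integrals are constant from index `n` on. -/
theorem fourierCoeff_eq (hf : Martingale f (filtration m) (mu m)) {i n : ℕ} (hi : i < bigM m n) :
    fourierCoeff m f i = ∫ x, f n x * (starRingEnd ℂ) (psi m i x) ∂mu m := by
  refine Tendsto.limUnder_eq (tendsto_const_nhds.congr' ?_)
  filter_upwards [eventually_ge_atTop n] with k hk
  have h1 := condExp_bilin_of_stronglyMeasurable_right (m := filtration m n) (μ := mu m)
    (ContinuousLinearMap.mul ℝ ℂ) (f := f k) (g := fun x => (starRingEnd ℂ) (psi m i x))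
    (Complex.continuous_conj.comp_stronglyMeasurable (stronglyMeasurable_psi_filtration hi))
    ((hf.integrable k).mul_conj_psi i) (hf.integrable k)
  simp only [ContinuousLinearMap.mul_apply'] at h1
  rw [← integral_condExp ((filtration m).le n), ← integral_condExp ((filtration m).le n)
    (f := fun x => f k x * (starRingEnd ℂ) (psi m i x))]
  refine integral_congr_ae ?_
  refine EventuallyEq.trans ?_ h1.symm
  rw [condExp_of_stronglyMeasurable ((filtration m).le n) _ ((hf.integrable n).mul_conj_psi i)]
  · filter_upwards [hf.2 n k hk] with x hx
    rw [hx]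
  · exact (hf.1 n).mul
      (Complex.continuous_conj.comp_stronglyMeasurable (stronglyMeasurable_psi_filtration hi))

theorem partialSum_eq_integral (hf : Martingale f (filtration m) (mu m)) {a n : ℕ}
    (ha : a ≤ bigM m n) (x : Gm m) :
    partialSum m f a x = ∫ y, f n y * dirichlet m a (x - y) ∂mu m := by
  have h : ∀ k ∈ Finset.range a, fourierCoeff m f k * psi m k x =
      ∫ y, f n y * (starRingEnd ℂ) (psi m k y) * psi m k x ∂mu m := fun k hk => by
    rw [integral_mul_const, fourierCoeff_eq hf ((Finset.mem_range.1 hk).trans_le ha)]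
  rw [partialSum, Finset.sum_congr rfl h, ← integral_finsetSum]
  · refine integral_congr_ae (ae_of_all _ fun y => ?_)
    simp only [dirichlet, Finset.mul_sum, sub_eq_add_neg, psi_add, conj_psi]
    exact Finset.sum_congr rfl fun k _ => by ring
  · exact fun k _ => ((hf.integrable n).mul_conj_psi k).mul_const _

theorem stronglyMeasurable_partialSum (f : ℕ → Gm m → ℂ) (a : ℕ) :
    StronglyMeasurable (partialSum m f a) :=
  Finset.stronglyMeasurable_fun_sum _ fun k _ => (stronglyMeasurable_psi k).const_mul _

/-- If `M_s` divides `a ≤ M_n`, then `S_a f` is dominated by the values of `f_n` on the interval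
of level `s`. -/
theorem enorm_partialSum_le (hf : Martingale f (filtration m) (mu m)) {a s n : ℕ}
    (ha : a ≤ bigM m n) (hs : bigM m s ∣ a) (x : Gm m) {K : ℝ≥0∞}
    (hK : ∀ y ∈ interval m s x, ‖f n y‖ₑ ≤ K) :
    ‖partialSum m f a x‖ₑ ≤ bigM m n * (bigM m s : ℝ≥0∞)⁻¹ * K := by
  rw [partialSum_eq_integral hf ha]
  calc _ ≤ ∫⁻ y, ‖f n y * dirichlet m a (x - y)‖ₑ ∂mu m := enorm_integral_le_lintegral_enorm _
    _ ≤ ∫⁻ y, (interval m s x).indicator (fun _ => bigM m n * K) y ∂mu m := by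
        refine lintegral_mono fun y => ?_
        by_cases hy : y ∈ interval m s x
        · rw [Set.indicator_of_mem hy, enorm_mul, mul_comm]
          gcongr
          · rw [← ofReal_norm, ← ENNReal.ofReal_natCast]
            exact ENNReal.ofReal_le_ofReal ((norm_dirichlet_le a _).trans (by exact_mod_cast ha))
          · exact hK y hy
        · have : x - y ∉ interval m s 0 := fun h => hy fun j hj => (sub_eq_zero.1 (h j hj)).symm
          simp [dirichlet_eq_zero hs this]
    _ = _ := by
        rw [lintegral_indicator (measurableSet_interval m s x)]
        simp only [lintegral_const, Measure.restrict_apply_univ, mu_interval]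
        ring

end Martingales

/-! ### Part (a): boundedness of the restricted maximal operator -/

section RestrictedMaximal

variable {m : ℕ → ℕ} [hm : Fact (∀ k, 2 ≤ m k)] {f : ℕ → Gm m → ℂ}

theorem eLpNorm_ofReal_eq {Ω E : Type*} [MeasurableSpace Ω] {μ : Measure Ω} [TopologicalSpace E]
    [ENormedAddMonoid E] {p : ℝ} (hp : 0 < p) (g : Ω → E) :
    eLpNorm g (ENNReal.ofReal p) μ = (∫⁻ x, ‖g x‖ₑ ^ p ∂μ) ^ (1 / p) := by
  rw [eLpNorm_eq_lintegral_rpow_enorm_toReal (by simpa using hp) ENNReal.ofReal_ne_top,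
    ENNReal.toReal_ofReal hp.le]

omit hm in
theorem measurable_maximalFunction (hf : Martingale f (filtration m) (mu m)) :
    Measurable (maximalFunction m f) :=
  Measurable.iSup fun n => (((hf.1 n).mono ((filtration m).le n)).measurable).enorm

theorem measurable_restrictedMaximal (α : ℕ → ℕ) (f : ℕ → Gm m → ℂ) :
    Measurable (restrictedMaximal m α f) :=
  Measurable.iSup fun k => (stronglyMeasurable_partialSum f (α k)).measurable.enorm

/-- The same factor `B^(R+1)` arises twice for different reasons: inside the threshold as the bound
for `M_{N+1}/M_s` in the kernel estimate, and outside as the cost of the covering. -/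
theorem mu_mul_lt_restrictedMaximal_le (hf : Martingale f (filtration m) (mu m)) {B R : ℕ}
    (hB : ∀ k, m k ≤ B) {α : ℕ → ℕ} (hα : ∀ k, 0 < α k) (hR : ∀ k, rho m (α k) ≤ R) (t : ℝ≥0∞) :
    mu m {x | (B : ℝ≥0∞) ^ (R + 1) * t < restrictedMaximal m α f x} ≤
      (B : ℝ≥0∞) ^ (R + 1) * mu m {x | t < maximalFunction m f x} := by
  -- Restricting to `n ≤ s + R + 1` makes `Q s` a union of intervals of level `s + R + 1`; the extra
  -- `1` is there because `α_k` is below `M_{|α_k|+1}` only.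
  set Q : ℕ → Set (Gm m) := fun s => {y | ∃ n ≤ s + (R + 1), t < ‖f n y‖ₑ} with hQ
  have hinv : ∀ s, ∀ x ∈ Q s, interval m (s + (R + 1)) x ⊆ Q s := by
    rintro s x ⟨n, hn, hx⟩ y hy
    refine ⟨n, hn, ?_⟩
    rwa [eq_of_stronglyMeasurable_filtration (hf.1 n) (interval_anti hn x hy)]
  refine (measure_mono ?_).trans ((mu_exists_mem_interval_le hB (R + 1) Q hinv).trans ?_)
  · intro x hx
    obtain ⟨k, hk⟩ := lt_iSup_iff.1 (show _ < ⨆ k, ‖partialSum m f (α k) x‖ₑ from hx)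
    refine ⟨lowIndex m (α k), ?_⟩
    by_contra! H
    refine hk.not_ge ?_
    have hn : highIndex m (α k) + 1 ≤ lowIndex m (α k) + (R + 1) := by
      have := hR k
      rw [rho] at this
      omega
    refine (enorm_partialSum_le hf (lt_bigM_highIndex_succ (hα k)).le (bigM_lowIndex_dvd (α k)) x
      (K := t) fun y hy => ?_).trans ?_
    · by_contra! h
      exact H y hy ⟨_, hn, h⟩
    · gcongr
      have hM : (bigM m (lowIndex m (α k)) : ℝ≥0∞) ≠ 0 := by exact_mod_cast (bigM_pos _).ne'
      rw [← div_eq_mul_inv]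
      refine ENNReal.div_le_of_le_mul ?_
      exact_mod_cast (bigM_mono hn).trans (bigM_add_le hB _ _)
  · gcongr
    intro y hy
    obtain ⟨s, n, -, h⟩ := Set.mem_iUnion.1 hy
    exact h.trans_le (le_iSup (fun n => ‖f n y‖ₑ) n)

theorem eLpNorm_restrictedMaximal_le (hf : Martingale f (filtration m) (mu m)) {B R : ℕ}
    (hB : ∀ k, m k ≤ B) {α : ℕ → ℕ} (hα : ∀ k, 0 < α k) (hR : ∀ k, rho m (α k) ≤ R)
    {p : ℝ} (hp : 0 < p) :
    eLpNorm (restrictedMaximal m α f) (ENNReal.ofReal p) (mu m) ≤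
      (((B : ℝ≥0) ^ (R + 1) * ((B : ℝ≥0) ^ (R + 1)) ^ p) ^ (1 / p) : ℝ≥0) * hardyNorm m p f := by
  have hB0 : B ≠ 0 := by have := hB 0; have := hm.out 0; omega
  set A : ℝ≥0 := (B : ℝ≥0) ^ (R + 1) with hA
  have hA0 : A ≠ 0 := pow_ne_zero _ (by exact_mod_cast hB0)
  have hAc : ((B : ℝ≥0∞) ^ (R + 1)) = A := by rw [hA]; push_cast; rfl
  have hAp : ((A * A ^ p : ℝ≥0) : ℝ≥0∞) = A * (A : ℝ≥0∞) ^ p := by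
    rw [ENNReal.coe_mul, ENNReal.coe_rpow_of_nonneg _ hp.le]
  rw [hardyNorm, eLpNorm_ofReal_eq hp, eLpNorm_ofReal_eq hp,
    ENNReal.coe_rpow_of_nonneg _ (by positivity),
    ← ENNReal.mul_rpow_of_nonneg _ _ (by positivity : 0 ≤ 1 / p)]
  gcongr
  simp only [enorm_eq_self]
  have key : ∫⁻ x, restrictedMaximal m α f x ^ p ∂mu m ≤
      (A : ℝ≥0∞) * ∫⁻ x, ((A : ℝ≥0∞) * maximalFunction m f x) ^ p ∂mu m := by
    refine lintegral_le_mul_of_meas_lt_le ((measurable_restrictedMaximal α f).pow_const p)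
      (((measurable_maximalFunction hf).const_mul _).pow_const p) ENNReal.coe_ne_top
      fun t ht => ?_
    -- The layer-cake comparison is applied to `p`-th powers, so level `t` there is level `t^(1/p)`
    -- here; dividing by `A` absorbs the factor in the threshold.
    have h := mu_mul_lt_restrictedMaximal_le hf hB hα hR ((t : ℝ≥0∞) ^ p⁻¹ / A)
    have hA1 : (A : ℝ≥0∞) ≠ 0 := by exact_mod_cast hA0
    rw [hAc, ENNReal.mul_div_cancel hA1 ENNReal.coe_ne_top] at h
    simpa only [ENNReal.rpow_inv_lt_iff hp,
      ENNReal.div_lt_iff (Or.inl hA1) (Or.inl ENNReal.coe_ne_top), mul_comm _ (A : ℝ≥0∞)] using h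
  refine key.trans (le_of_eq ?_)
  simp_rw [ENNReal.mul_rpow_of_nonneg _ _ hp.le]
  rw [lintegral_const_mul _ ((measurable_maximalFunction hf).pow_const p), hAp, mul_assoc]

theorem memLp_restrictedMaximal {p : ℝ} (hp : 0 < p) (hf : MemHardy m p f) {B R : ℕ}
    (hB : ∀ k, m k ≤ B) {α : ℕ → ℕ} (hα : ∀ k, 0 < α k) (hR : ∀ k, rho m (α k) ≤ R) :
    MemLp (restrictedMaximal m α f) (ENNReal.ofReal p) (mu m) :=
  ⟨(measurable_restrictedMaximal α f).aestronglyMeasurable,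
    (eLpNorm_restrictedMaximal_le hf.1 hB hα hR hp).trans_lt
      (ENNReal.mul_lt_top ENNReal.coe_lt_top hf.2)⟩

end RestrictedMaximal

/-! ### A lower bound for geometric sums of roots of unity -/

theorem sin_pi_div_le_sin_mul {n d : ℕ} (hd : 0 < d) (hdn : d < n) :
    Real.sin (Real.pi / n) ≤ Real.sin (Real.pi * d / n) := by
  have hn : (0 : ℝ) < n := by exact_mod_cast hd.trans hdn
  have hpi := Real.pi_pos
  have key : ∀ e : ℕ, 0 < e → 2 * e ≤ n →
      Real.sin (Real.pi / n) ≤ Real.sin (Real.pi * e / n) := by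
    intro e he hen
    have he1 : (1 : ℝ) ≤ e := by exact_mod_cast he
    have hen' : (2 * e : ℝ) ≤ n := by exact_mod_cast hen
    refine Real.sin_le_sin_of_le_of_le_pi_div_two ?_ ?_ ?_
    · have : 0 < Real.pi / n := by positivity
      linarith
    · rw [div_le_div_iff₀ hn two_pos]; nlinarith
    · gcongr; nlinarith
  -- The reflection `d ↦ n - d` preserves the sine and reduces to the range where it is increasing.
  rcases le_total (2 * d) n with h | h
  · exact key d hd h
  · have h1 : Real.pi * d / n = Real.pi - Real.pi * (n - d : ℕ) / n := by
      rw [Nat.cast_sub hdn.le]; field_simp; ring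
    rw [h1, Real.sin_pi_sub]
    exact key _ (by omega) (by omega)

/-- With `ω = exp(2πi/n)` the norm equals `|ω^d - 1| / |ω - 1| = sin(πd/n) / sin(π/n)`. -/
theorem one_le_norm_geom_sum_stdAddChar {n d : ℕ} [NeZero n] (hd : 0 < d) (hdn : d < n) :
    1 ≤ ‖∑ t ∈ Finset.range d, (ZMod.stdAddChar (1 : ZMod n) : ℂ) ^ t‖ := by
  have hn : (0 : ℝ) < n := by exact_mod_cast hd.trans hdn
  have hpow : ∀ e : ℕ, (ZMod.stdAddChar (1 : ZMod n) : ℂ) ^ e =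
      Complex.exp (Complex.I * ((2 * (Real.pi * e / n) : ℝ) : ℂ)) := by
    intro e
    rw [← AddChar.map_nsmul_eq_pow, nsmul_eq_mul, mul_one]
    have := ZMod.stdAddChar_coe (N := n) (e : ℤ)
    simp only [Int.cast_natCast] at this
    rw [this]
    congr 1
    push_cast
    ring
  have hnorm : ∀ e : ℕ, ‖(ZMod.stdAddChar (1 : ZMod n) : ℂ) ^ e - 1‖ =
      2 * |Real.sin (Real.pi * e / n)| := by
    intro e
    rw [hpow, Complex.norm_exp_I_mul_ofReal_sub_one, mul_div_cancel_left₀ _ two_ne_zero]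
    simp
  have hn1 : (1 : ℝ) < n := by exact_mod_cast (Nat.succ_le_of_lt hd).trans_lt hdn
  have hpos : 0 < Real.sin (Real.pi / n) := Real.sin_pos_of_pos_of_lt_pi
    (div_pos Real.pi_pos hn) (div_lt_self Real.pi_pos hn1)
  have h1 := hnorm 1
  rw [pow_one, Nat.cast_one, mul_one, abs_of_pos hpos] at h1
  have hle : ‖(ZMod.stdAddChar (1 : ZMod n) : ℂ) - 1‖ ≤
      ‖(ZMod.stdAddChar (1 : ZMod n) : ℂ) ^ d - 1‖ := by
    rw [h1, hnorm d]
    gcongr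
    exact (sin_pi_div_le_sin_mul hd hdn).trans (le_abs_self _)
  have hp1 : 0 < ‖(ZMod.stdAddChar (1 : ZMod n) : ℂ) - 1‖ := by rw [h1]; positivity
  rw [geom_sum_eq (sub_ne_zero.1 (norm_pos_iff.1 hp1)), norm_div, one_le_div hp1]
  exact hle

/-! ### Part (b): block martingales, their Hardy norm and their partial sums -/

section Blocks

variable {m : ℕ → ℕ} [hm : Fact (∀ k, 2 ≤ m k)]

/-- Strip from `a` its digits above `s = ⟨a⟩`: their kernel is supported in `I_{s+1}(0)`, which
misses `x`. What remains is a unimodular factor times `M_s` times a geometric sum of `a_s` terms, of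
norm at least `1`. -/
theorem bigM_lowIndex_le_norm_dirichlet {a : ℕ} (ha : 0 < a) {x : Gm m}
    (hx : x ∈ interval m (lowIndex m a) 0) (hx1 : x (lowIndex m a) = 1) :
    (bigM m (lowIndex m a) : ℝ) ≤ ‖dirichlet m a x‖ := by
  classical
  have hd0 := digit_lowIndex_ne_zero (m := m) ha
  obtain ⟨q, hq⟩ := bigM_lowIndex_dvd (m := m) a
  set s := lowIndex m a with hs
  have hdlt := digit_lt (m := m) a s
  set d := digit m a s with hd
  have hqd : d = q % m s := by
    rw [hd, digit, hq, Nat.mul_div_cancel_left _ (bigM_pos s)]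
  have hne : x ∉ interval m (s + 1) 0 := by
    intro h
    have h0 := h s (Nat.lt_succ_self s)
    rw [hx1, ← sub_eq_zero, Pi.zero_apply, sub_zero] at h0
    have : Fact (1 < m s) := ⟨hm.out s⟩
    exact one_ne_zero h0
  have ha' : a = (q / m s * m s + d) * bigM m s := by
    rw [hqd, Nat.div_add_mod', hq, mul_comm]
  rw [ha', dirichlet_add_mul, dirichlet_eq_zero (s := s + 1) _ hne, zero_add, dirichlet_bigM,
    if_pos hx, norm_mul, Complex.norm_natCast]
  · have hterm : ∀ t ∈ Finset.range d, psi m ((q / m s * m s + t) * bigM m s) x =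
        psi m (q / m s * bigM m (s + 1)) x * (ZMod.stdAddChar (1 : ZMod (m s)) : ℂ) ^ t := by
      intro t ht
      have htm := (Finset.mem_range.1 ht).trans hdlt
      have hlt : t * bigM m s < bigM m (s + 1) := by
        rw [bigM_succ]; exact Nat.mul_lt_mul_of_pos_right htm (bigM_pos s)
      rw [add_mul, mul_assoc, ← bigM_succ, psi_mul_add _ hlt, psi_mul_bigM htm,
        rademacher_eq_stdAddChar, hx1]
    rw [Finset.sum_congr rfl hterm, ← Finset.mul_sum, norm_mul, norm_psi, one_mul]
    exact le_mul_of_one_le_left (Nat.cast_nonneg _)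
      (one_le_norm_geom_sum_stdAddChar (Nat.pos_of_ne_zero hd0) hdlt)
  · rw [mul_assoc, ← bigM_succ]
    exact Dvd.intro_left _ rfl

/-- The martingale `∑_{i < n} c_i (D_{M_{i+1}} - D_{M_i})`. -/
noncomputable def blockMartingale (m : ℕ → ℕ) (c : ℕ → ℝ≥0) (n : ℕ) (x : Gm m) : ℂ :=
  ∑ i ∈ Finset.range n, ((c i : ℝ) : ℂ) *
    (dirichlet m (bigM m (i + 1)) x - dirichlet m (bigM m i) x)

theorem integrable_of_norm_le {g : Gm m → ℂ} (hg : StronglyMeasurable g) {C : ℝ}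
    (h : ∀ x, ‖g x‖ ≤ C) : Integrable g (mu m) :=
  Integrable.of_bound hg.aestronglyMeasurable C (ae_of_all _ h)

theorem integrable_dirichlet (a : ℕ) : Integrable (dirichlet m a) (mu m) :=
  integrable_of_norm_le (stronglyMeasurable_dirichlet a) (norm_dirichlet_le a)

theorem integrable_dirichlet_sub (a b : ℕ) :
    Integrable (fun x => dirichlet m a x - dirichlet m b x) (mu m) :=
  (integrable_dirichlet a).sub (integrable_dirichlet b)

theorem integrable_blockMartingale (c : ℕ → ℝ≥0) (n : ℕ) :
    Integrable (blockMartingale m c n) (mu m) :=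
  integrable_finsetSum _ fun _ _ => (integrable_dirichlet_sub _ _).const_mul _

/-- The `n`-th increment involves only `ψ_k` with `M_n ≤ k < M_{n+1}`, and these integrate to zero
over every set of level `n`. -/
theorem martingale_blockMartingale (c : ℕ → ℝ≥0) :
    Martingale (blockMartingale m c) (filtration m) (mu m) := by
  refine martingale_of_setIntegral_eq_succ (fun n => ?_) (integrable_blockMartingale c) ?_
  · refine stronglyMeasurable_filtration_of_const fun x y hy => ?_
    refine Finset.sum_congr rfl fun i hi => ?_
    have hi := Finset.mem_range.1 hi
    have h : ∀ a ≤ bigM m n, dirichlet m a y = dirichlet m a x := fun a ha =>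
      Finset.sum_congr rfl fun k hk =>
        psi_eq_of_mem_interval ((Finset.mem_range.1 hk).trans_le ha) hy
    rw [h _ (bigM_mono hi), h _ (bigM_mono hi.le)]
  · intro n A hA
    have hstep : ∀ x, blockMartingale m c (n + 1) x = blockMartingale m c n x +
        ((c n : ℝ) : ℂ) * ∑ k ∈ Finset.Ico (bigM m n) (bigM m (n + 1)), psi m k x := by
      intro x
      rw [blockMartingale, Finset.sum_range_succ, Finset.sum_Ico_eq_sub _ (bigM_mono n.le_succ)]
      rfl
    have hpsi : ∀ k, Integrable (psi m k) ((mu m).restrict A) := fun k =>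
      (integrable_of_norm_le (stronglyMeasurable_psi k) fun x => (norm_psi k x).le).restrict
    simp_rw [hstep]
    rw [integral_add (integrable_blockMartingale c n).restrict
      ((integrable_finsetSum _ fun k _ => hpsi k).const_mul _), integral_const_mul,
      integral_finsetSum _ fun k _ => hpsi k, Finset.sum_eq_zero, mul_zero, add_zero]
    exact fun k hk => setIntegral_psi_eq_zero (Finset.mem_Ico.1 hk).1 hA

theorem integral_dirichlet_mul_conj_psi (a k : ℕ) :
    ∫ x, dirichlet m a x * (starRingEnd ℂ) (psi m k x) ∂mu m = if k < a then 1 else 0 := by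
  simp only [dirichlet, Finset.sum_mul]
  rw [integral_finsetSum _ fun l _ => (integrable_of_norm_le (stronglyMeasurable_psi l)
    fun x => (norm_psi l x).le).mul_conj_psi k]
  simp [integral_psi_mul_conj_psi]

theorem integral_blockMartingale_mul_conj_psi (c : ℕ → ℝ≥0) (n k : ℕ) :
    ∫ x, blockMartingale m c n x * (starRingEnd ℂ) (psi m k x) ∂mu m =
      ∑ i ∈ Finset.range n, ((c i : ℝ) : ℂ) *
        ((if k < bigM m (i + 1) then 1 else 0) - if k < bigM m i then 1 else 0) := by
  simp only [blockMartingale, Finset.sum_mul, mul_assoc]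
  rw [integral_finsetSum _ fun i _ =>
    ((integrable_dirichlet_sub _ _).mul_conj_psi k).const_mul _]
  refine Finset.sum_congr rfl fun i _ => ?_
  rw [integral_const_mul]
  simp only [sub_mul]
  rw [integral_sub ((integrable_dirichlet _).mul_conj_psi k)
    ((integrable_dirichlet _).mul_conj_psi k), integral_dirichlet_mul_conj_psi,
    integral_dirichlet_mul_conj_psi]

theorem fourierCoeff_blockMartingale (c : ℕ → ℝ≥0) {i k : ℕ} (h1 : bigM m i ≤ k)
    (h2 : k < bigM m (i + 1)) : fourierCoeff m (blockMartingale m c) k = ((c i : ℝ) : ℂ) := by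
  rw [fourierCoeff_eq (martingale_blockMartingale c) h2, integral_blockMartingale_mul_conj_psi,
    Finset.sum_range_succ, Finset.sum_eq_zero, zero_add, if_pos h2, if_neg h1.not_gt, sub_zero,
    mul_one]
  intro j hj
  have hj := Finset.mem_range.1 hj
  have h3 := (bigM_mono (m := m) hj).trans h1
  have h4 := (bigM_mono (m := m) hj.le).trans h1
  rw [if_neg h3.not_gt, if_neg h4.not_gt, sub_zero, mul_zero]

theorem partialSum_blockMartingale_sub (c : ℕ → ℝ≥0) {N a : ℕ} (h1 : bigM m N ≤ a)
    (h2 : a ≤ bigM m (N + 1)) (x : Gm m) :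
    partialSum m (blockMartingale m c) a x - partialSum m (blockMartingale m c) (bigM m N) x =
      ((c N : ℝ) : ℂ) * (dirichlet m a x - dirichlet m (bigM m N) x) := by
  rw [partialSum, partialSum, dirichlet, dirichlet, ← Finset.sum_Ico_eq_sub _ h1,
    ← Finset.sum_Ico_eq_sub _ h1, Finset.mul_sum]
  refine Finset.sum_congr rfl fun k hk => ?_
  have hk := Finset.mem_Ico.1 hk
  rw [fourierCoeff_blockMartingale c hk.1 (hk.2.trans_le h2)]

theorem partialSum_blockMartingale_bigM (c : ℕ → ℝ≥0) (N : ℕ) (x : Gm m) :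
    partialSum m (blockMartingale m c) (bigM m N) x = blockMartingale m c N x := by
  induction N with
  | zero =>
    -- `f_0` is an empty sum, so the martingale has mean zero and `S_1 f = f_0`.
    have : fourierCoeff m (blockMartingale m c) 0 = 0 := by
      rw [fourierCoeff_eq (n := 0) (martingale_blockMartingale c) (bigM_pos 0)]
      simp [blockMartingale]
    simp [partialSum, bigM, this, blockMartingale]
  | succ N ih =>
    have := partialSum_blockMartingale_sub c (bigM_mono (m := m) N.le_succ) le_rfl x
    rw [sub_eq_iff_eq_add, ih] at this
    rw [this, blockMartingale, blockMartingale, Finset.sum_range_succ, add_comm]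

theorem partialSum_blockMartingale (c : ℕ → ℝ≥0) {N a : ℕ} (h1 : bigM m N ≤ a)
    (h2 : a ≤ bigM m (N + 1)) (x : Gm m) :
    partialSum m (blockMartingale m c) a x = blockMartingale m c N x +
      ((c N : ℝ) : ℂ) * (dirichlet m a x - dirichlet m (bigM m N) x) := by
  rw [← partialSum_blockMartingale_sub c h1 h2, partialSum_blockMartingale_bigM,
    add_sub_cancel]

/-- Both kernels of block `i` vanish off `I_i(0)`; on it they are at most `B M_i` and `M_i`, whence
`B + 1`. -/
theorem enorm_blockMartingale_le {B : ℕ} (hB : ∀ k, m k ≤ B) (c : ℕ → ℝ≥0) (n : ℕ) (x : Gm m) :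
    ‖blockMartingale m c n x‖ₑ ≤ ∑ i ∈ Finset.range n,
      (interval m i 0).indicator (fun _ => (((B + 1) * c i * bigM m i : ℝ≥0) : ℝ≥0∞)) x := by
  classical
  refine (enorm_sum_le _ _).trans (Finset.sum_le_sum fun i _ => ?_)
  rw [dirichlet_bigM, dirichlet_bigM]
  by_cases hx : x ∈ interval m i 0
  · rw [if_pos hx, Set.indicator_of_mem hx, enorm_le_coe, ← NNReal.coe_le_coe, coe_nnnorm, norm_mul]
    have h1 : ‖(if x ∈ interval m (i + 1) 0 then (bigM m (i + 1) : ℂ) else 0) - bigM m i‖ ≤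
        (B + 1) * bigM m i := by
      refine (norm_sub_le _ _).trans ?_
      have h2 : (bigM m (i + 1) : ℝ) ≤ B * bigM m i := by
        rw [bigM_succ]; exact_mod_cast Nat.mul_le_mul_right _ (hB i)
      have h3 : (0 : ℝ) ≤ B * bigM m i := by positivity
      rw [Complex.norm_natCast, add_mul, one_mul]
      gcongr
      split_ifs
      · rwa [Complex.norm_natCast]
      · rwa [norm_zero]
    push_cast
    rw [Complex.norm_of_nonneg (c i).coe_nonneg]
    calc (c i : ℝ) * _ ≤ c i * ((B + 1) * bigM m i) := by gcongr
      _ = _ := by ring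
  · rw [if_neg hx, if_neg fun h => hx (interval_anti i.le_succ _ h)]
    simp

theorem rpow_sum_le_sum_rpow {ι : Type*} (s : Finset ι) (a : ι → ℝ≥0∞) {p : ℝ} (hp : 0 < p)
    (hp1 : p ≤ 1) : (∑ i ∈ s, a i) ^ p ≤ ∑ i ∈ s, a i ^ p := by
  classical
  induction s using Finset.induction_on with
  | empty => simp [hp]
  | insert i s hi ih =>
    rw [Finset.sum_insert hi, Finset.sum_insert hi]
    exact (ENNReal.rpow_add_le_add_rpow _ _ hp.le hp1).trans (by gcongr)

/-- The pointwise majorant has nonnegative terms, so its `p`-subadditive bound is uniform in `n` and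
survives the supremum; each term then contributes its height to the power `p` times `μ(I_i(0)) =
1/M_i`. -/
theorem lintegral_maximalFunction_blockMartingale_le {B : ℕ} (hB : ∀ k, m k ≤ B) (c : ℕ → ℝ≥0)
    {p : ℝ} (hp : 0 < p) (hp1 : p ≤ 1) :
    ∫⁻ x, maximalFunction m (blockMartingale m c) x ^ p ∂mu m ≤
      ∑' i, (((B + 1) * c i * bigM m i : ℝ≥0) : ℝ≥0∞) ^ p * (bigM m i : ℝ≥0∞)⁻¹ := by
  calc _ ≤ ∫⁻ x, ∑' i, (interval m i 0).indicator
        (fun _ => (((B + 1) * c i * bigM m i : ℝ≥0) : ℝ≥0∞) ^ p) x ∂mu m := by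
        refine lintegral_mono fun x => ?_
        rw [← ENNReal.le_rpow_inv_iff hp]
        refine iSup_le fun n => ?_
        rw [ENNReal.le_rpow_inv_iff hp]
        refine (ENNReal.rpow_le_rpow (enorm_blockMartingale_le hB c n x) hp.le).trans
          ((rpow_sum_le_sum_rpow _ _ hp hp1).trans (le_trans (le_of_eq ?_)
          (ENNReal.sum_le_tsum (Finset.range n))))
        refine Finset.sum_congr rfl fun i _ => ?_
        by_cases hx : x ∈ interval m i 0 <;> simp [hx, hp]
    _ = _ := by
        rw [lintegral_tsum fun i =>
          (measurable_const.indicator (measurableSet_interval m i 0)).aemeasurable]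
        refine tsum_congr fun i => ?_
        rw [lintegral_indicator (measurableSet_interval m i 0)]
        simp [mu_interval]

theorem memHardy_blockMartingale {B : ℕ} (hB : ∀ k, m k ≤ B) (c : ℕ → ℝ≥0)
    {p : ℝ} (hp : 0 < p) (hp1 : p ≤ 1)
    (hc : ∑' i, (((B + 1) * c i * bigM m i : ℝ≥0) : ℝ≥0∞) ^ p * (bigM m i : ℝ≥0∞)⁻¹ ≠ ⊤) :
    MemHardy m p (blockMartingale m c) := by
  refine ⟨martingale_blockMartingale c, ?_⟩
  rw [hardyNorm, eLpNorm_ofReal_eq hp]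
  refine ENNReal.rpow_lt_top_of_nonneg (by positivity) ?_
  exact ((lintegral_maximalFunction_blockMartingale_le hB c hp hp1).trans_lt hc.lt_top).ne

omit hm in
theorem rpow_mul_mu_lt_le_weakNorm_rpow {p : ℝ} (hp : 0 < p) (g : Gm m → ℂ) {t : ℝ≥0}
    (ht : 0 < t) : (t : ℝ≥0∞) ^ p * mu m {x | (t : ℝ≥0∞) < ‖g x‖ₑ} ≤ weakNorm m p g ^ p := by
  have h : (t : ℝ≥0∞) * (mu m {x | (t : ℝ≥0∞) < ‖g x‖ₑ}) ^ (1 / p) ≤ weakNorm m p g :=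
    le_iSup₂ (f := fun (t : ℝ≥0) (_ : 0 < t) =>
      (t : ℝ≥0∞) * (mu m {x | (t : ℝ≥0∞) < ‖g x‖ₑ}) ^ (1 / p)) t ht
  have h2 := ENNReal.rpow_le_rpow h hp.le
  rwa [ENNReal.mul_rpow_of_nonneg _ _ hp.le, ← ENNReal.rpow_mul, one_div,
    inv_mul_cancel₀ hp.ne', ENNReal.rpow_one] at h2

/-- The size of `S_a f` near the low index of `a`, for a block martingale `f`. -/
theorem rpow_le_weakNorm_partialSum_blockMartingale {p : ℝ} (hp : 0 < p) (c : ℕ → ℝ≥0) {a : ℕ}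
    (ha : 0 < a) (hlt : lowIndex m a < highIndex m a) {t : ℝ≥0} (ht : 0 < t)
    (htc : t * 4 = c (highIndex m a) * bigM m (lowIndex m a)) :
    (t : ℝ≥0∞) ^ p * (bigM m (lowIndex m a + 1) : ℝ≥0∞)⁻¹ ≤
      weakNorm m p (partialSum m (blockMartingale m c) a) ^ p +
        ∫⁻ x, maximalFunction m (blockMartingale m c) x ^ p ∂mu m := by
  classical
  set f := blockMartingale m c
  set s := lowIndex m a
  set N := highIndex m a
  -- On this interval `c_N |D_a| ≥ 4t` and `D_{M_N} = 0`. If `|S_a f|` and `|f_N|` were both at most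
  -- `t`, their difference `c_N D_a` would have norm at most `2t`.
  have hsub : interval m (s + 1) (Pi.single s 1) ⊆
      {x | (t : ℝ≥0∞) < ‖partialSum m f a x‖ₑ} ∪ {x | (t : ℝ≥0∞) ≤ maximalFunction m f x} := by
    intro x hx
    have hxs : x ∈ interval m s 0 := fun j hj => by
      rw [hx j (hj.trans s.lt_succ_self), Pi.single_eq_of_ne hj.ne]; rfl
    have hx1 : x s = 1 := by rw [hx s s.lt_succ_self, Pi.single_eq_same]
    have hxN : x ∉ interval m N 0 := fun h => by
      have h0 := h s hlt
      rw [hx1] at h0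
      have : Fact (1 < m s) := ⟨hm.out s⟩
      exact one_ne_zero h0
    have hD := bigM_lowIndex_le_norm_dirichlet ha hxs hx1
    have hS := partialSum_blockMartingale c (bigM_highIndex_le (m := m) ha)
      (lt_bigM_highIndex_succ ha).le x
    rw [dirichlet_eq_zero dvd_rfl hxN, sub_zero] at hS
    by_contra H
    simp only [Set.mem_union, Set.mem_ofPred_eq, not_or, not_lt, not_le] at H
    have h1 : ‖partialSum m f a x‖ ≤ t := by
      have := H.1
      rwa [enorm_le_coe, ← NNReal.coe_le_coe, coe_nnnorm] at this
    have h2 : ‖f N x‖ ≤ t := by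
      have := (le_iSup (fun n => ‖f n x‖ₑ) N).trans H.2.le
      rwa [enorm_le_coe, ← NNReal.coe_le_coe, coe_nnnorm] at this
    have h3 : ‖((c N : ℝ) : ℂ) * dirichlet m a x‖ ≤ t + t := by
      have h4 : ((c N : ℝ) : ℂ) * dirichlet m a x = partialSum m f a x - f N x :=
        eq_sub_of_add_eq' hS.symm
      rw [h4]
      exact (norm_sub_le _ _).trans (add_le_add h1 h2)
    rw [norm_mul, Complex.norm_of_nonneg (c N).coe_nonneg] at h3
    have h5 : (t : ℝ) * 4 = c N * bigM m s := by exact_mod_cast htc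
    have h6 : (c N : ℝ) * bigM m s ≤ c N * ‖dirichlet m a x‖ := by gcongr
    have h7 : (0 : ℝ) < t := ht
    linarith
  rw [← mu_interval (s + 1) (Pi.single s 1)]
  calc _ ≤ (t : ℝ≥0∞) ^ p * (mu m {x | (t : ℝ≥0∞) < ‖partialSum m f a x‖ₑ} +
        mu m {x | (t : ℝ≥0∞) ≤ maximalFunction m f x}) := by
        gcongr
        exact (measure_mono hsub).trans (measure_union_le _ _)
    _ ≤ _ := by
        rw [mul_add]
        refine add_le_add (rpow_mul_mu_lt_le_weakNorm_rpow hp _ ht) ?_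
        -- Markov's inequality for the `p`-th power of `f^*`.
        have h := mul_meas_ge_le_lintegral (μ := mu m) ((measurable_maximalFunction
          (martingale_blockMartingale (m := m) c)).pow_const p) ((t : ℝ≥0∞) ^ p)
        simpa only [ENNReal.rpow_le_rpow_iff hp] using h

end Blocks

/-- Weight `i` collects `2^(-j)` over all `j` with `N j = i`. Repeated values of `N` do no harm, so
no strictly increasing subsequence of high indices has to be extracted. -/
theorem exists_summable_weights (N : ℕ → ℕ) :
    ∃ b : ℕ → ℝ≥0, ∑' i, (b i : ℝ≥0∞) ≠ ⊤ ∧ ∀ j, (2 : ℝ≥0)⁻¹ ^ j ≤ b (N j) := by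
  set w : ℕ → ℝ≥0∞ := fun i => ∑' j, if N j = i then (2 : ℝ≥0∞)⁻¹ ^ j else 0 with hw
  have hsum : ∑' i, w i ≠ ⊤ := by
    rw [hw, ENNReal.tsum_comm]
    have h : ∀ j, ∑' i, (if N j = i then (2 : ℝ≥0∞)⁻¹ ^ j else 0) = (2 : ℝ≥0∞)⁻¹ ^ j := fun j => by
      rw [tsum_eq_single (N j) fun i hi => if_neg hi.symm, if_pos rfl]
    simp_rw [h]
    rw [ENNReal.tsum_geometric, ENNReal.one_sub_inv_two, inv_inv]
    exact ENNReal.ofNat_ne_top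
  have hfin : ∀ i, w i ≠ ⊤ := fun i => ne_top_of_le_ne_top hsum (ENNReal.le_tsum i)
  refine ⟨fun i => (w i).toNNReal, by simpa [ENNReal.coe_toNNReal (hfin _)] using hsum,
    fun j => ?_⟩
  rw [← ENNReal.coe_le_coe, ENNReal.coe_toNNReal (hfin _)]
  have h := ENNReal.le_tsum (f := fun j' => if N j' = N j then (2 : ℝ≥0∞)⁻¹ ^ j' else 0) j
  simp only [if_true] at h
  refine le_trans (le_of_eq ?_) h
  rw [ENNReal.coe_pow, ENNReal.coe_inv two_ne_zero]
  rfl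

/-! ### Part (b): choice of coefficients and divergence -/

section Divergence

variable {m : ℕ → ℕ} [hm : Fact (∀ k, 2 ≤ m k)]

/-- The coefficient `c` with `c ^ p * M_i ^ (p - 1) = b`. -/
noncomputable def blockCoeff (m : ℕ → ℕ) (p : ℝ) (b : ℝ≥0) (i : ℕ) : ℝ≥0 :=
  (b * (bigM m i : ℝ≥0) ^ (1 - p)) ^ (1 / p)

omit hm in
theorem blockCoeff_rpow {p : ℝ} (hp : 0 < p) (b : ℝ≥0) (i : ℕ) :
    blockCoeff m p b i ^ p = b * (bigM m i : ℝ≥0) ^ (1 - p) := by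
  rw [blockCoeff, ← NNReal.rpow_mul, one_div, inv_mul_cancel₀ hp.ne', NNReal.rpow_one]

theorem memHardy_blockMartingale_blockCoeff {B : ℕ} (hB : ∀ k, m k ≤ B) {p : ℝ} (hp : 0 < p)
    (hp1 : p ≤ 1) {b : ℕ → ℝ≥0} (hb : ∑' i, (b i : ℝ≥0∞) ≠ ⊤) :
    MemHardy m p (blockMartingale m fun i => blockCoeff m p (b i) i) := by
  refine memHardy_blockMartingale hB _ hp hp1 ?_
  have h : ∀ i, (((B + 1) * blockCoeff m p (b i) i * bigM m i : ℝ≥0) : ℝ≥0∞) ^ p *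
      (bigM m i : ℝ≥0∞)⁻¹ = (((B + 1 : ℝ≥0) ^ p : ℝ≥0) : ℝ≥0∞) * b i := by
    intro i
    have hM : (bigM m i : ℝ≥0) ≠ 0 := by exact_mod_cast (bigM_pos i).ne'
    rw [← ENNReal.coe_rpow_of_nonneg _ hp.le, ← ENNReal.coe_natCast (bigM m i),
      ← ENNReal.coe_inv hM, ← ENNReal.coe_mul, ← ENNReal.coe_mul, NNReal.mul_rpow,
      NNReal.mul_rpow, blockCoeff_rpow hp]
    congr 1
    have h2 : (bigM m i : ℝ≥0) ^ (1 - p) * (bigM m i : ℝ≥0) ^ p = bigM m i := by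
      rw [← NNReal.rpow_add hM, sub_add_cancel, NNReal.rpow_one]
    calc _ = (B + 1 : ℝ≥0) ^ p * b i * (((bigM m i : ℝ≥0) ^ (1 - p) * (bigM m i : ℝ≥0) ^ p) *
          (bigM m i : ℝ≥0)⁻¹) := by ring
      _ = _ := by rw [h2, mul_inv_cancel₀ hM, mul_one]
  simp_rw [h]
  rw [ENNReal.tsum_mul_left]
  exact ENNReal.mul_ne_top ENNReal.coe_ne_top hb

/-- By the choice of coefficient and `M_{s+1} ≤ B M_s`, the right side is at least `b
(M_N/M_s)^(1-p) / (4^p B)`. Since `M_N/M_s ≥ 2^(N-s)`, the condition on `j` makes the power at least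
`2^(2j)`; half of this exponent pays for `b ≥ 2^(-j)` and `2^j` is left over. -/
theorem two_pow_le_rpow_blockCoeff {B : ℕ} (hB : ∀ k, m k ≤ B) {p : ℝ} (hp : 0 < p) (hp1 : p < 1)
    {b : ℝ≥0} {s N j : ℕ} (hsN : s ≤ N) (hj : 2 * (j : ℝ) ≤ (N - s : ℕ) * (1 - p))
    (hb : (2 : ℝ≥0)⁻¹ ^ j ≤ b) :
    (2 : ℝ≥0) ^ j * ((4 : ℝ≥0) ^ p * B)⁻¹ ≤
      (blockCoeff m p b N * bigM m s / 4) ^ p * (bigM m (s + 1) : ℝ≥0)⁻¹ := by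
  have hM : ∀ i, (0 : ℝ≥0) < bigM m i := fun i => by exact_mod_cast bigM_pos i
  have hB0 : (0 : ℝ≥0) < B := by
    have := hB 0
    have := hm.out 0
    exact_mod_cast (by omega : 0 < B)
  have hMB : (bigM m (s + 1) : ℝ≥0) ≤ B * bigM m s := by
    rw [bigM_succ]; exact_mod_cast Nat.mul_le_mul_right _ (hB s)
  have hMN : (2 : ℝ≥0) ^ (N - s) * bigM m s ≤ bigM m N := by
    have := two_pow_mul_bigM_le (m := m) s (N - s)
    rw [Nat.add_sub_cancel' hsN] at this
    exact_mod_cast this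
  have h4 : (2 : ℝ≥0) ^ (2 * j) ≤ ((2 : ℝ≥0) ^ (N - s)) ^ (1 - p) := by
    rw [← NNReal.rpow_natCast, ← NNReal.rpow_natCast, ← NNReal.rpow_mul]
    refine NNReal.rpow_le_rpow_of_exponent_le one_le_two ?_
    push_cast
    exact hj
  have key : (2 : ℝ≥0) ^ j * bigM m s ≤
      b * (bigM m N : ℝ≥0) ^ (1 - p) * (bigM m s : ℝ≥0) ^ p := by
    calc (2 : ℝ≥0) ^ j * bigM m s = (2 : ℝ≥0)⁻¹ ^ j * (2 : ℝ≥0) ^ (2 * j) *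
          ((bigM m s : ℝ≥0) ^ (1 - p) * (bigM m s : ℝ≥0) ^ p) := by
          rw [← NNReal.rpow_add (hM s).ne', sub_add_cancel, NNReal.rpow_one, two_mul, pow_add,
            ← mul_assoc, ← mul_pow, inv_mul_cancel₀ two_ne_zero, one_pow, one_mul]
      _ ≤ b * ((2 : ℝ≥0) ^ (N - s)) ^ (1 - p) *
          ((bigM m s : ℝ≥0) ^ (1 - p) * (bigM m s : ℝ≥0) ^ p) := by gcongr
      _ = b * ((2 : ℝ≥0) ^ (N - s) * bigM m s) ^ (1 - p) * (bigM m s : ℝ≥0) ^ p := by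
          rw [NNReal.mul_rpow]; ring
      _ ≤ _ := by
          have : 0 ≤ 1 - p := by linarith
          gcongr
  rw [NNReal.div_rpow, NNReal.mul_rpow, blockCoeff_rpow hp]
  rw [← div_eq_mul_inv, ← div_eq_mul_inv, div_div,
    div_le_div_iff₀ (mul_pos (NNReal.rpow_pos (by norm_num)) hB0)
      (mul_pos (NNReal.rpow_pos (by norm_num)) (hM _))]
  calc (2 : ℝ≥0) ^ j * ((4 : ℝ≥0) ^ p * bigM m (s + 1))
      ≤ (2 : ℝ≥0) ^ j * ((4 : ℝ≥0) ^ p * (B * bigM m s)) := by gcongr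
    _ = (2 : ℝ≥0) ^ j * bigM m s * ((4 : ℝ≥0) ^ p * B) := by ring
    _ ≤ _ := by gcongr

theorem exists_memHardy_iSup_weakNorm_eq_top {B : ℕ} (hB : ∀ k, m k ≤ B) {p : ℝ} (hp : 0 < p)
    (hp1 : p < 1) {α : ℕ → ℕ} (hα : ∀ k, 0 < α k)
    (hρ : ¬ BddAbove (Set.range fun k => rho m (α k))) :
    ∃ f : ℕ → Gm m → ℂ, MemHardy m p f ∧ ⨆ k, weakNorm m p (partialSum m f (α k)) = ⊤ := by
  have hex : ∀ j : ℕ, ∃ k, 0 < rho m (α k) ∧ 2 * (j : ℝ) ≤ rho m (α k) * (1 - p) := by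
    intro j
    -- Strictly exceeding this natural number also yields `ρ > 0` when `j = 0`.
    obtain ⟨_, ⟨k, rfl⟩, hk⟩ := not_bddAbove_iff.1 hρ ⌈2 * (j : ℝ) / (1 - p)⌉₊
    refine ⟨k, by simp only at hk; omega, ?_⟩
    rw [← div_le_iff₀ (by linarith)]
    exact (Nat.le_ceil _).trans (by exact_mod_cast hk.le)
  choose k hk0 hk using hex
  obtain ⟨b, hb, hbj⟩ := exists_summable_weights fun j => highIndex m (α (k j))
  set c : ℕ → ℝ≥0 := fun i => blockCoeff m p (b i) i
  have hf := memHardy_blockMartingale_blockCoeff hB hp hp1.le hb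
  refine ⟨_, hf, ?_⟩
  by_contra H
  set W := ⨆ k, weakNorm m p (partialSum m (blockMartingale m c) (α k))
  have hH : ∫⁻ x, maximalFunction m (blockMartingale m c) x ^ p ∂mu m ≠ ⊤ := by
    have h := hf.2
    rw [hardyNorm, eLpNorm_ofReal_eq hp, ENNReal.rpow_lt_top_iff_of_pos (by positivity)] at h
    exact h.ne
  have hbound : W ^ p + ∫⁻ x, maximalFunction m (blockMartingale m c) x ^ p ∂mu m ≠ ⊤ :=
    ENNReal.add_ne_top.2 ⟨ENNReal.rpow_ne_top_of_nonneg hp.le H, hH⟩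
  have hB0 : (B : ℝ≥0) ≠ 0 := by
    have := hB 0
    have := hm.out 0
    exact_mod_cast (by omega : B ≠ 0)
  set D : ℝ≥0 := ((4 : ℝ≥0) ^ p * B)⁻¹
  have hD0 : 0 < D := inv_pos.2 (mul_pos (NNReal.rpow_pos (by norm_num)) (pos_iff_ne_zero.2 hB0))
  have hle : ∀ j : ℕ, (((2 : ℝ≥0) ^ j * D : ℝ≥0) : ℝ≥0∞) ≤
      W ^ p + ∫⁻ x, maximalFunction m (blockMartingale m c) x ^ p ∂mu m := by
    intro j
    set a := α (k j)
    have hlt : lowIndex m a < highIndex m a := Nat.lt_of_sub_pos (hk0 j)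
    have hest := two_pow_le_rpow_blockCoeff hB hp hp1 hlt.le (hk j) (hbj j)
    set t : ℝ≥0 := blockCoeff m p (b (highIndex m a)) (highIndex m a) *
      bigM m (lowIndex m a) / 4 with ht
    -- The weight is not assumed positive separately; `t = 0` would contradict the lower bound
    -- `hest`.
    have ht0 : 0 < t := by
      rw [pos_iff_ne_zero]
      intro h0
      rw [h0, NNReal.zero_rpow hp.ne', zero_mul] at hest
      exact (mul_pos (pow_pos two_pos j) hD0).not_ge hest
    have hw := rpow_le_weakNorm_partialSum_blockMartingale hp c (hα (k j)) hlt ht0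
      (div_mul_cancel₀ _ four_ne_zero)
    calc (((2 : ℝ≥0) ^ j * D : ℝ≥0) : ℝ≥0∞)
        ≤ ((t ^ p * (bigM m (lowIndex m a + 1) : ℝ≥0)⁻¹ : ℝ≥0) : ℝ≥0∞) := by exact_mod_cast hest
      _ = (t : ℝ≥0∞) ^ p * (bigM m (lowIndex m a + 1) : ℝ≥0∞)⁻¹ := by
          have hM : (bigM m (lowIndex m a + 1) : ℝ≥0) ≠ 0 := by exact_mod_cast (bigM_pos _).ne'
          rw [ENNReal.coe_mul, ENNReal.coe_rpow_of_nonneg _ hp.le, ENNReal.coe_inv hM,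
            ENNReal.coe_natCast]
      _ ≤ _ := hw
      _ ≤ _ := by
          gcongr
          exact le_iSup (fun k => weakNorm m p (partialSum m (blockMartingale m c) (α k))) (k j)
  -- The bound is finite and independent of `j`, while `2^j D` grows without limit.
  obtain ⟨j, hj⟩ := pow_unbounded_of_one_lt
    ((W ^ p + ∫⁻ x, maximalFunction m (blockMartingale m c) x ^ p ∂mu m).toNNReal / D)
    (one_lt_two (α := ℝ≥0))
  rw [div_lt_iff₀ hD0] at hj
  have h := hle j
  rw [← ENNReal.coe_toNNReal hbound, ENNReal.coe_le_coe] at h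
  exact h.not_gt hj

end Divergence

end Vilenkin

theorem theorem1 (m : ℕ → ℕ) (hm : ∀ k, 2 ≤ m k) (hbdd : BddAbove (Set.range m)) :
    (∀ p : ℝ, 0 < p → p ≤ 1 → ∀ α : ℕ → ℕ, (∀ k, 0 < α k) →
      BddAbove (Set.range fun k => Vilenkin.rho m (α k)) →
      ∃ C : ℝ≥0, ∀ f : ℕ → Vilenkin.Gm m → ℂ, Vilenkin.MemHardy m p f →
        MemLp (Vilenkin.restrictedMaximal m α f) (ENNReal.ofReal p) (Vilenkin.mu m) ∧
        eLpNorm (Vilenkin.restrictedMaximal m α f) (ENNReal.ofReal p) (Vilenkin.mu m) ≤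
          C * Vilenkin.hardyNorm m p f) ∧
    (∀ p : ℝ, 0 < p → p < 1 → ∀ α : ℕ → ℕ, (∀ k, 0 < α k) →
      ¬ BddAbove (Set.range fun k => Vilenkin.rho m (α k)) →
      ∃ f : ℕ → Vilenkin.Gm m → ℂ, Vilenkin.MemHardy m p f ∧
        ⨆ k, Vilenkin.weakNorm m p (Vilenkin.partialSum m f (α k)) = ⊤) := by
  have : Fact (∀ k, 2 ≤ m k) := ⟨hm⟩
  obtain ⟨B, hB⟩ := hbdd
  have hB' : ∀ k, m k ≤ B := fun k => hB ⟨k, rfl⟩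
  refine ⟨fun p hp _ α hα ⟨R, hR⟩ => ?_, fun p hp hp1 α hα hρ =>
    Vilenkin.exists_memHardy_iSup_weakNorm_eq_top hB' hp hp1 hα hρ⟩
  have hR' : ∀ k, Vilenkin.rho m (α k) ≤ R := fun k => hR ⟨k, rfl⟩
  exact ⟨_, fun f hf => ⟨Vilenkin.memLp_restrictedMaximal hp hf hB' hα hR',
    Vilenkin.eLpNorm_restrictedMaximal_le hf.1 hB' hα hR' hp⟩⟩
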